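/- For $\beta\in[-2,2]$ let $P(t,\beta)=\sum_{n\ge 0}a_n(\beta)(1-t)^n$, $-1<t\le 1$, with $a_0=1$ and $a_{n+1}=\frac{a_n}{2}\cdot\frac{n^2+n-\beta}{(n+1)^2}$, be the Legendre function of the first kind, which solves $(1-t^2)P''-2tP'+\beta P=0$. Let $0\le c\le 0.58828$, and put $f_c(t)=a\,P\!\left(t,\frac{2}{1+c^2}\right)$ with a normalization constant $a\neq 0$ and $g_c(t)=P\!\left(t,-\frac{1/4}{1+c^2}\right)$. Then $f_c$ has exactly one zero $t_c$ in $(-1,1]$, and $t_c<1$. The function $$G_c(t)=\frac{9/4}{1+c^2}\,f_c(t)^2+(1-t^2)\left(f_c'(t)-f_c(t)\,\frac{g_c'(t)}{g_c(t)}\right)^2$$ satisfies $G_c'(t)>0$ for $t_c<t<1$ (for every $a\neq 0$). Consequently, let $\tilde f_c(\phi)=f_c(\cos\phi)$ and $\tilde g_c(\phi)=g_c(\cos\phi)$, and let $a>0$ be chosen such that $\tilde f_c'(\phi_c)=-1$, where $\phi_c=\arccos t_c$ (such an $a$ exists). Consider the cone $\mathcal C=\{y\in\mathbb R^4: y_4=c\,(y_1^2+y_2^2+y_3^2)^{1/2}\}$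 with the metric inherited from $\mathbb R^4$, its gradient $\nabla_c$ and Laplace--Beltrami operator $\Delta_c$, and the coordinates $(y_1,y_2,y_3)$, where $r=(y_1^2+y_2^2+y_3^2)^{1/2}$ and $y_3=r\cos\phi$. For every $\varepsilon>0$ the function $v=\max\{r\tilde f_c(\phi)-\varepsilon r^{-1/2}\tilde g_c(\phi),0\}$, extended by $0$ to the vertex and to $\phi=\pi$, is a subsolution of the one-phase free boundary problem on every open subset $\Omega$ of the cone: $v\ge 0$ and $v$ is continuous in $\Omega$; away from the vertex, $v$ is $C^2$ with $\Delta_c v\ge 0$ in $\Omega\cap\{v>0\}$; and $\lim_{\rho\to 0}\sup_{B_\rho(x)}|\nabla_c v|>1$ for every $x\in\Omega\cap\partial\{v>0\}$ other than the vertex. -/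

import Mathlib

open Set Filter Topology

noncomputable section

/-- Coefficients of the power series in `1 - t` of the Legendre function of the first kind:
`a₀ = 1` and `aₙ₊₁ = (aₙ / 2) (n² + n - β) / (n + 1)²`. -/
def legendreCoeff (β : ℝ) : ℕ → ℝ
  | 0 => 1
  | n + 1 => legendreCoeff β n / 2 * (((n : ℝ) ^ 2 + n - β) / ((n : ℝ) + 1) ^ 2)

/-- The Legendre function of the first kind, `f(t, β) = ∑ aₙ(β) (1 - t)ⁿ`, the solution of
`(1 - t²) f'' - 2 t f' + β f = 0` on `(-1, 1]` with `f(1, β) = 1`. -/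
def legendreFn (β t : ℝ) : ℝ := ∑' n : ℕ, legendreCoeff β n * (1 - t) ^ n

/-- `f_c` with value `a` at `t = 1`: the Legendre function with `β = 2 / (1 + c²)`, times `a`. -/
def fCone (c a t : ℝ) : ℝ := a * legendreFn (2 / (1 + c ^ 2)) t

/-- `g_c`, the Legendre function with `β = -(1/4) / (1 + c²)`. -/
def gCone (c t : ℝ) : ℝ := legendreFn (-(1 / 4) / (1 + c ^ 2)) t

/-- `G_c(t) = (9/4)/(1+c²) f_c² + (1 - t²) (f_c' - f_c g_c' / g_c)²`. -/
def GCone (c a t : ℝ) : ℝ :=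
  9 / 4 / (1 + c ^ 2) * fCone c a t ^ 2 +
    (1 - t ^ 2) * (deriv (fCone c a) t - fCone c a t * (deriv (gCone c) t / gCone c t)) ^ 2

/-- The global parametrization of the cone `y₄ = c √(y₁² + y₂² + y₃²)` in `ℝ⁴` by
`(y₁, y₂, y₃) ∈ ℝ³`. Functions on the cone are written as functions of `(y₁, y₂, y₃)`. -/
def coneParam (c : ℝ) (y : EuclideanSpace ℝ (Fin 3)) : EuclideanSpace ℝ (Fin 4) :=
  !₂[y 0, y 1, y 2, c * ‖y‖]

/-- The `j`-th coordinate partial derivative on `ℝ³`. -/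
def partialD {F : Type*} [NormedAddCommGroup F] [NormedSpace ℝ F] (j : Fin 3)
    (h : EuclideanSpace ℝ (Fin 3) → F) (y : EuclideanSpace ℝ (Fin 3)) : F :=
  fderiv ℝ h y (EuclideanSpace.single j 1)

/-- The metric that the cone inherits from `ℝ⁴`, in the coordinates `(y₁, y₂, y₃)`, away from the
vertex: `g_ij = δ_ij + c² y_i y_j / |y|²` (see `coneMetric_eq_inner`). -/
def coneMetric (c : ℝ) (y : EuclideanSpace ℝ (Fin 3)) : Matrix (Fin 3) (Fin 3) ℝ :=
  Matrix.of fun i j => (if i = j then 1 else 0) + c ^ 2 * (y i * y j) / ‖y‖ ^ 2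

theorem coneMetric_eq_inner (c : ℝ) {y : EuclideanSpace ℝ (Fin 3)} (hy : y ≠ 0) (i j : Fin 3) :
    coneMetric c y i j = inner ℝ (partialD i (coneParam c) y) (partialD j (coneParam c) y) := by
  have hn : HasFDerivAt (fun z : EuclideanSpace ℝ (Fin 3) => ‖z‖)
      (‖y‖⁻¹ • innerSL ℝ y) y := by
    have h1 := (hasStrictFDerivAt_norm_sq y).hasFDerivAt.sqrt
      (pow_ne_zero 2 (norm_ne_zero_iff.2 hy))
    have h2 : (fun z : EuclideanSpace ℝ (Fin 3) => √(‖z‖ ^ 2)) = fun z => ‖z‖ := by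
      funext z
      exact Real.sqrt_sq (norm_nonneg z)
    rw [h2] at h1
    have h4 : ‖y‖⁻¹ • innerSL ℝ y = (1 / (2 * √(‖y‖ ^ 2))) • 2 • innerSL ℝ y := by
      rw [Real.sqrt_sq (norm_nonneg y), ← Nat.cast_smul_eq_nsmul ℝ, smul_smul]
      congr 1
      have := norm_ne_zero_iff.2 hy
      push_cast
      field_simp
    rw [h4]
    exact h1
  have hp : ∀ k : Fin 3, HasFDerivAt (fun z : EuclideanSpace ℝ (Fin 3) => z k)
      (EuclideanSpace.proj k : EuclideanSpace ℝ (Fin 3) →L[ℝ] ℝ) y := fun k =>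
    (EuclideanSpace.proj k : EuclideanSpace ℝ (Fin 3) →L[ℝ] ℝ).hasFDerivAt
  have hd : ∀ k : Fin 3, ∀ m : Fin 4, (partialD k (coneParam c) y) m =
      ![if k = 0 then 1 else 0, if k = 1 then 1 else 0, if k = 2 then 1 else 0,
        c * (‖y‖⁻¹ * y k)] m := by
    intro k m
    have hdiff : DifferentiableAt ℝ (coneParam c) y := by
      rw [differentiableAt_euclidean]
      intro m
      fin_cases m
      · exact (hp 0).differentiableAt
      · exact (hp 1).differentiableAt
      · exact (hp 2).differentiableAt
      · exact hn.differentiableAt.const_mul c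
    have hm : (partialD k (coneParam c) y) m =
        fderiv ℝ (fun z => coneParam c z m) y (EuclideanSpace.single k 1) := by
      have := ((EuclideanSpace.proj m : EuclideanSpace ℝ (Fin 4) →L[ℝ] ℝ).hasFDerivAt.comp y
        hdiff.hasFDerivAt).fderiv
      have h3 : (fun z => coneParam c z m) =
        (EuclideanSpace.proj m : EuclideanSpace ℝ (Fin 4) →L[ℝ] ℝ) ∘ coneParam c := rfl
      rw [h3, this]
      rfl
    rw [hm]
    fin_cases m
    · have : fderiv ℝ (fun z => coneParam c z 0) y = EuclideanSpace.proj 0 := (hp 0).fderiv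
      simp [this, eq_comm]
    · have : fderiv ℝ (fun z => coneParam c z 1) y = EuclideanSpace.proj 1 := (hp 1).fderiv
      simp [this, eq_comm]
    · have : fderiv ℝ (fun z => coneParam c z 2) y = EuclideanSpace.proj 2 := (hp 2).fderiv
      simp [this, eq_comm]
    · have : fderiv ℝ (fun z => coneParam c z 3) y = c • (‖y‖⁻¹ • innerSL ℝ y) :=
        (hn.const_mul c).fderiv
      simp [this, EuclideanSpace.inner_single_right]
  have hyn : ‖y‖ ≠ 0 := norm_ne_zero_iff.2 hy
  simp only [coneMetric, Matrix.of_apply, PiLp.inner_apply, hd, Fin.sum_univ_four]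
  fin_cases i <;> fin_cases j <;> simp <;> field_simp <;> simp [sq_abs]

/-- `|∇_c v|² = g^{ij} ∂_i v ∂_j v`. -/
def coneGradSq (c : ℝ) (v : EuclideanSpace ℝ (Fin 3) → ℝ) (y : EuclideanSpace ℝ (Fin 3)) : ℝ :=
  ∑ i : Fin 3, ∑ j : Fin 3, (coneMetric c y)⁻¹ i j * partialD i v y * partialD j v y

/-- The Laplace-Beltrami operator `Δ_c v = (det g)^{-1/2} ∂_j ((det g)^{1/2} g^{ij} ∂_i v)` of the
cone, away from the vertex. -/
def coneLaplacian (c : ℝ) (v : EuclideanSpace ℝ (Fin 3) → ℝ) (y : EuclideanSpace ℝ (Fin 3)) : ℝ :=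
  (√(coneMetric c y).det)⁻¹ * ∑ j : Fin 3, partialD j
    (fun z => √(coneMetric c z).det * ∑ i : Fin 3, (coneMetric c z)⁻¹ i j * partialD i v z) y

/-- `v` is a (classical) subsolution of the one-phase free boundary problem on the part of the cone
over `Ω`. The vertex is excluded where differential operators of the cone appear. -/
structure IsConeSubsolution (c : ℝ) (Ω : Set (EuclideanSpace ℝ (Fin 3)))
    (v : EuclideanSpace ℝ (Fin 3) → ℝ) : Prop where
  nonneg : ∀ y ∈ Ω, 0 ≤ v y
  continuousOn : ContinuousOn v Ω
  contDiffOn : ContDiffOn ℝ 2 v {y | y ∈ Ω ∧ 0 < v y ∧ y ≠ 0}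
  laplacian_nonneg : ∀ y ∈ Ω, 0 < v y → y ≠ 0 → 0 ≤ coneLaplacian c v y
  /-- `lim_{ρ → 0} sup_{B_ρ(x)} |∇_c v| > 1` at each free boundary point other than the vertex -/
  one_lt_grad : ∀ x ∈ Ω, x ∈ frontier {y | y ∈ Ω ∧ 0 < v y} → x ≠ 0 →
    1 < limsup (fun y => ENNReal.ofReal √(coneGradSq c v y)) (𝓝 x)

/-- `max {r f_c(cos φ) - ε r^{-1/2} g_c(cos φ), 0}` with `r = |y|` and `cos φ = y₃ / |y|`, and `0`
at the vertex and on the half-line `φ = π`, where `f_c` and `g_c` are not defined. -/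
def coneSub (c a ε : ℝ) (y : EuclideanSpace ℝ (Fin 3)) : ℝ :=
  if -‖y‖ < y 2 then
    max (‖y‖ * fCone c a (y 2 / ‖y‖) - ε * ‖y‖ ^ (-(1 / 2) : ℝ) * gCone c (y 2 / ‖y‖)) 0
  else 0

end

/-! Put κ = 1/(1+c²), f = P(·, 2κ), g = P(·, -κ/4), H = g'/g and Q(t) = t - (1-t²)H. On functions
r^α p(cos φ) the cone Laplacian acts as r^(α-2) [(1-t²)p'' - 2tp' + κα(α+1)p], so r f and r^(-1/2) g
are both harmonic: α = 1 gives 2κ, and α = -1/2 gives -κ/4. At a free boundary point ε r^(-3/2) is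
the quotient f_c/g_c; substituting this into |∇v|² eliminates ε and r and leaves exactly G_c(t). The
normalization of a says G_c(t_c) = 1, so monotonicity of G_c yields a gradient larger than 1. The
vertex and the half-line φ = π are harmless, because v vanishes near them.

By the two differential equations, G_c' = a² [(9/2)κ f² H + 2(f' - fH)² Q] (`hasDerivAt_GCone`).
Only the first term is negative, since H ≤ 0 and Q turns out to be nonnegative. It is absorbed as
follows. As f' ≥ κ, AM-GM gives (f' - fH)² ≥ 4κ f(-H). Concavity gives f ≤ D(t - t_c) with D =
f'(t_c), and D < 4/3 (`deriv_legendreFn_zero_lt`). The Riccati equation for H gives Q' ≥ 3/4, so Q ≥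
(3/4)(t - t_c) once Q(t_c) ≥ 0 (`slopeFn_nonneg_of_zero`). These constants fit exactly.

The condition Q(t_c) ≥ 0 is where the bound on c enters. Sturm comparison in κ reduces it to κ =
0.7429 and the single point t = -0.2039, where partial sums of the series decide. -/

/-! ### Power series converging for |x| < 2 -/

/-- The sum of the power series with coefficients `a`. -/
noncomputable def powSum (a : ℕ → ℝ) (x : ℝ) : ℝ := ∑' n : ℕ, a n * x ^ n

/-- The coefficients of the formal derivative. -/
noncomputable def derivCoeff (a : ℕ → ℝ) (n : ℕ) : ℝ := (n + 1) * a (n + 1)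

/-- The coefficients of the power series multiplied by the variable. -/
noncomputable def shiftCoeff (a : ℕ → ℝ) : ℕ → ℝ
  | 0 => 0
  | n + 1 => a n

/-- `2ⁿ aₙ` has at most polynomial growth; the power series then converges for `|x| < 2`. -/
def PolyGeo (a : ℕ → ℝ) : Prop :=
  ∃ (C : ℝ) (k : ℕ), 0 ≤ C ∧ ∀ n, |a n| ≤ C * ((n : ℝ) + 1) ^ k * (1 / 2) ^ n

theorem PolyGeo.derivCoeff {a : ℕ → ℝ} (ha : PolyGeo a) : PolyGeo (derivCoeff a) := by
  obtain ⟨C, k, hC, h⟩ := ha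
  refine ⟨C * 2 ^ k, k + 1, by positivity, fun n => ?_⟩
  have h1 := h (n + 1)
  have hn : (0 : ℝ) ≤ n := Nat.cast_nonneg n
  rw [_root_.derivCoeff, abs_mul, abs_of_nonneg (by positivity)]
  have h2 : ((n + 1 : ℕ) : ℝ) + 1 ≤ 2 * ((n : ℝ) + 1) := by push_cast; linarith
  have h3 : (((n + 1 : ℕ) : ℝ) + 1) ^ k ≤ (2 * ((n : ℝ) + 1)) ^ k := by gcongr
  calc ((n : ℝ) + 1) * |a (n + 1)|
      ≤ ((n : ℝ) + 1) * (C * (2 * ((n : ℝ) + 1)) ^ k * (1 / 2) ^ (n + 1)) := by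
        gcongr
        exact h1.trans (by gcongr)
    _ = (C * 2 ^ k * ((n : ℝ) + 1) ^ (k + 1) * (1 / 2) ^ n) * (1 / 2) := by
        rw [mul_pow]; ring
    _ ≤ (C * 2 ^ k * ((n : ℝ) + 1) ^ (k + 1) * (1 / 2) ^ n) := by
        have : 0 ≤ (C * 2 ^ k * ((n : ℝ) + 1) ^ (k + 1) * (1 / 2) ^ n) := by positivity
        linarith

theorem PolyGeo.summable_bound {a : ℕ → ℝ} (ha : PolyGeo a) {r : ℝ} (hr : 0 ≤ r) (hr2 : r < 2) :
    Summable fun n => |a n| * r ^ n := by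
  obtain ⟨C, k, hC, h⟩ := ha
  have h1 : Summable fun n : ℕ => ((n : ℝ) ^ k * (r / 2) ^ n : ℝ) :=
    summable_pow_mul_geometric_of_norm_lt_one k
      (by rw [Real.norm_eq_abs, abs_of_nonneg (by positivity)]; linarith)
  have h0 : Summable fun n : ℕ => ((r / 2) ^ n : ℝ) :=
    summable_geometric_of_lt_one (by positivity) (by linarith)
  have h2 : Summable fun n : ℕ => (C * 2 ^ k) * ((n : ℝ) ^ k * (r / 2) ^ n + (r / 2) ^ n) :=
    (h1.add h0).mul_left _
  refine Summable.of_nonneg_of_le (fun n => by positivity) (fun n => ?_) h2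
  have h3 : ((n : ℝ) + 1) ^ k ≤ 2 ^ k * ((n : ℝ) ^ k + 1) := by
    rcases Nat.eq_zero_or_pos n with rfl | hn
    · simp
      rcases Nat.eq_zero_or_pos k with rfl | hk
      · simp
      · rw [zero_pow hk.ne']; simpa using one_le_pow₀ (by norm_num : (1 : ℝ) ≤ 2)
    · have hn1 : (1 : ℝ) ≤ n := by exact_mod_cast hn
      have : ((n : ℝ) + 1) ^ k ≤ (2 * (n : ℝ)) ^ k := by gcongr; linarith
      rw [mul_pow] at this
      have h4 : (0 : ℝ) ≤ 2 ^ k := by positivity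
      linarith
  calc |a n| * r ^ n ≤ (C * ((n : ℝ) + 1) ^ k * (1 / 2) ^ n) * r ^ n := by gcongr; exact h n
    _ = C * ((n : ℝ) + 1) ^ k * (r / 2) ^ n := by rw [div_eq_mul_one_div r 2, mul_pow]; ring
    _ ≤ C * (2 ^ k * ((n : ℝ) ^ k + 1)) * (r / 2) ^ n := by gcongr
    _ = _ := by ring

theorem PolyGeo.summable {a : ℕ → ℝ} (ha : PolyGeo a) {x : ℝ} (hx : |x| < 2) :
    Summable fun n => a n * x ^ n := by
  refine Summable.of_norm ?_
  simpa [abs_mul, abs_pow] using ha.summable_bound (abs_nonneg x) hx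

theorem PolyGeo.hasDerivAt {a : ℕ → ℝ} (ha : PolyGeo a) {x : ℝ} (hx : |x| < 2) :
    HasDerivAt (powSum a) (powSum (_root_.derivCoeff a) x) x := by
  obtain ⟨r, hxr, hr2⟩ := exists_between hx
  have hr : 0 < r := (abs_nonneg x).trans_lt hxr
  have hu : Summable fun n : ℕ => (n : ℝ) * |a n| * r ^ (n - 1) := by
    rw [← summable_nat_add_iff 1]
    refine (ha.derivCoeff.summable_bound hr.le hr2).congr fun n => ?_
    rw [_root_.derivCoeff, abs_mul, abs_of_nonneg (by positivity : (0 : ℝ) ≤ n + 1)]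
    push_cast
    simp
  -- Termwise differentiation on the ball of radius r with |x| < r < 2, where the differentiated
  -- series has a summable majorant.
  have key := hasDerivAt_tsum_of_isPreconnected (g := fun n y => a n * y ^ n)
    (g' := fun n y => a n * (n * y ^ (n - 1))) (t := Metric.ball (0 : ℝ) r) (y₀ := 0) (y := x)
    hu Metric.isOpen_ball (convex_ball _ _).isPreconnected
    (fun n y _ => (hasDerivAt_pow n y).const_mul _)
    (fun n y hy => by
      have hy' : |y| ≤ r := by simpa using (mem_ball_zero_iff.1 hy).le
      rw [Real.norm_eq_abs, abs_mul, abs_mul, abs_pow, Nat.abs_cast]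
      calc |a n| * (n * |y| ^ (n - 1)) = n * |a n| * |y| ^ (n - 1) := by ring
        _ ≤ _ := by gcongr)
    (by simpa using hr) (ha.summable (by simp)) (by simpa using hxr)
  have hs : Summable fun n : ℕ => a n * (n * x ^ (n - 1)) := by
    refine Summable.of_norm_bounded hu fun n => ?_
    rw [Real.norm_eq_abs, abs_mul, abs_mul, abs_pow, Nat.abs_cast]
    calc |a n| * (n * |x| ^ (n - 1)) = n * |a n| * |x| ^ (n - 1) := by ring
        _ ≤ _ := by gcongr
  have : powSum (_root_.derivCoeff a) x = ∑' n : ℕ, a n * (n * x ^ (n - 1)) := by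
    rw [hs.tsum_eq_zero_add, powSum]
    simp only [Nat.cast_zero, zero_mul, mul_zero, zero_add]
    refine tsum_congr fun n => ?_
    rw [_root_.derivCoeff]; push_cast; ring_nf
  rw [this]
  exact key

theorem PolyGeo.contDiffOn {a : ℕ → ℝ} (ha : PolyGeo a) (n : ℕ) :
    ContDiffOn ℝ n (powSum a) (Ioo (-2) 2) := by
  induction n generalizing a with
  | zero =>
    exact contDiffOn_zero.2 fun x hx =>
      (ha.hasDerivAt (abs_lt.2 hx)).continuousAt.continuousWithinAt
  | succ n ih =>
    push_cast
    rw [contDiffOn_succ_iff_deriv_of_isOpen isOpen_Ioo]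
    refine ⟨fun x hx => (ha.hasDerivAt (abs_lt.2 hx)).differentiableAt.differentiableWithinAt,
      by simp, ?_⟩
    exact (ih ha.derivCoeff).congr fun x hx => (ha.hasDerivAt (abs_lt.2 hx)).deriv

theorem hasSum_mul_shiftCoeff {a : ℕ → ℝ} {x s : ℝ} (h : HasSum (fun n => a n * x ^ n) s) :
    HasSum (fun n => shiftCoeff a n * x ^ n) (x * s) := by
  rw [← hasSum_nat_add_iff' 1]
  simp only [shiftCoeff, Finset.sum_range_one, zero_mul, sub_zero]
  have e : (fun n => a n * x ^ (n + 1)) = fun n => x * (a n * x ^ n) := by funext n; ring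
  rw [e]
  exact h.mul_left x

/-! ### Legendre functions: equation, signs of coefficients, elementary bounds -/

theorem legendreCoeff_succ (β : ℝ) (n : ℕ) : legendreCoeff β (n + 1) =
    legendreCoeff β n / 2 * (((n : ℝ) ^ 2 + n - β) / ((n : ℝ) + 1) ^ 2) := rfl

theorem legendreCoeff_zero (β : ℝ) : legendreCoeff β 0 = 1 := rfl

theorem legendreCoeff_one (β : ℝ) : legendreCoeff β 1 = -β / 2 := by
  rw [legendreCoeff_succ, legendreCoeff_zero]; simp; ring

theorem polyGeo_legendreCoeff {β : ℝ} (h₁ : -1 ≤ β) (h₂ : β ≤ 2) : PolyGeo (legendreCoeff β) := by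
  -- From n = 1 on, the factor (n²+n-β)/(n+1)² lies in [0, 1]. The constant 2 is what |a₁| = |β|/2 ≤
  -- 1 requires.
  refine ⟨2, 0, by norm_num, fun n => ?_⟩
  simp only [pow_zero, mul_one]
  induction n with
  | zero => simp [legendreCoeff_zero]
  | succ n ih =>
    rcases Nat.eq_zero_or_pos n with rfl | hn
    · rw [zero_add, legendreCoeff_one, abs_le]; constructor <;> norm_num <;> linarith
    · have hn1 : (1 : ℝ) ≤ n := by exact_mod_cast hn
      have hq0 : 0 ≤ ((n : ℝ) ^ 2 + n - β) / ((n : ℝ) + 1) ^ 2 :=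
        div_nonneg (by nlinarith) (by positivity)
      have hq1 : ((n : ℝ) ^ 2 + n - β) / ((n : ℝ) + 1) ^ 2 ≤ 1 := by
        rw [div_le_one (by positivity)]; nlinarith
      rw [legendreCoeff_succ, abs_mul, abs_div, abs_two, abs_of_nonneg hq0, pow_succ (1 / 2 : ℝ)]
      calc |legendreCoeff β n| / 2 * _ ≤ |legendreCoeff β n| / 2 * 1 := by gcongr
        _ ≤ _ := by linarith

theorem legendreFn_ode_series {β : ℝ} (h₁ : -1 ≤ β) (h₂ : β ≤ 2) {x : ℝ} (hx : |x| < 2) :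
    x * (2 - x) * powSum (derivCoeff (derivCoeff (legendreCoeff β))) x
      + 2 * (1 - x) * powSum (derivCoeff (legendreCoeff β)) x
      + β * powSum (legendreCoeff β) x = 0 := by
  have ha := polyGeo_legendreCoeff h₁ h₂
  have s0 := (ha.summable hx).hasSum
  have s1 := (ha.derivCoeff.summable hx).hasSum
  have s2 := hasSum_mul_shiftCoeff (ha.derivCoeff.derivCoeff.summable hx).hasSum
  have s3 := hasSum_mul_shiftCoeff s2
  have s4 := hasSum_mul_shiftCoeff s1
  have key := ((((s2.mul_left 2).sub s3).add (s1.mul_left 2)).sub (s4.mul_left 2)).add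
    (s0.mul_left β)
  -- With x = 1 - t and 1 - t² = 2x - x², comparing coefficients of xⁿ returns the recursion. The
  -- cases n = 0, 1 are separate because the shifts remove terms there.
  have hz : (fun n => 2 * (shiftCoeff (derivCoeff (derivCoeff (legendreCoeff β))) n * x ^ n)
      - shiftCoeff (shiftCoeff (derivCoeff (derivCoeff (legendreCoeff β)))) n * x ^ n
      + 2 * (derivCoeff (legendreCoeff β) n * x ^ n)
      - 2 * (shiftCoeff (derivCoeff (legendreCoeff β)) n * x ^ n)
      + β * (legendreCoeff β n * x ^ n)) = fun _ => (0 : ℝ) := by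
    funext n
    rcases n with _ | _ | n
    · simp [shiftCoeff, derivCoeff, legendreCoeff_one, legendreCoeff_zero]; ring
    · simp only [shiftCoeff, derivCoeff, zero_add]
      rw [legendreCoeff_succ β 1]
      push_cast; ring
    · simp only [shiftCoeff, derivCoeff]
      rw [legendreCoeff_succ β (n + 2)]
      have : ((n + 2 : ℕ) : ℝ) + 1 ≠ 0 := by positivity
      push_cast at this ⊢
      field_simp
      ring
  rw [hz] at key
  have := key.unique hasSum_zero
  simp only [powSum]
  linarith

theorem legendreFn_eq_powSum (β : ℝ) :
    legendreFn β = fun t => powSum (legendreCoeff β) (1 - t) := rfl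

theorem abs_one_sub_lt {t : ℝ} (ht : t ∈ Ioo (-1 : ℝ) 3) : |1 - t| < 2 := by
  rw [abs_lt]; constructor <;> linarith [ht.1, ht.2]

theorem PolyGeo.hasDerivAt_one_sub {a : ℕ → ℝ} (ha : PolyGeo a) {t : ℝ}
    (ht : t ∈ Ioo (-1 : ℝ) 3) :
    HasDerivAt (fun s => powSum a (1 - s)) (-powSum (_root_.derivCoeff a) (1 - t)) t := by
  simpa using (ha.hasDerivAt (abs_one_sub_lt ht)).comp_const_sub 1 t

section Legendre

variable {β t : ℝ}

theorem hasDerivAt_legendreFn_series (h₁ : -1 ≤ β) (h₂ : β ≤ 2) (ht : t ∈ Ioo (-1 : ℝ) 3) :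
    HasDerivAt (legendreFn β) (-powSum (derivCoeff (legendreCoeff β)) (1 - t)) t :=
  (polyGeo_legendreCoeff h₁ h₂).hasDerivAt_one_sub ht

theorem deriv_legendreFn (h₁ : -1 ≤ β) (h₂ : β ≤ 2) (ht : t ∈ Ioo (-1 : ℝ) 3) :
    deriv (legendreFn β) t = -powSum (derivCoeff (legendreCoeff β)) (1 - t) :=
  (hasDerivAt_legendreFn_series h₁ h₂ ht).deriv

theorem hasDerivAt_legendreFn (h₁ : -1 ≤ β) (h₂ : β ≤ 2) (ht : t ∈ Ioo (-1 : ℝ) 3) :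
    HasDerivAt (legendreFn β) (deriv (legendreFn β) t) t :=
  (hasDerivAt_legendreFn_series h₁ h₂ ht).differentiableAt.hasDerivAt

theorem hasDerivAt_deriv_legendreFn_series (h₁ : -1 ≤ β) (h₂ : β ≤ 2) (ht : t ∈ Ioo (-1 : ℝ) 3) :
    HasDerivAt (deriv (legendreFn β))
      (powSum (derivCoeff (derivCoeff (legendreCoeff β))) (1 - t)) t := by
  have h := ((polyGeo_legendreCoeff h₁ h₂).derivCoeff.hasDerivAt_one_sub ht).neg
  rw [neg_neg] at h
  refine h.congr_of_eventuallyEq ?_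
  filter_upwards [isOpen_Ioo.mem_nhds ht] with s hs
  exact deriv_legendreFn h₁ h₂ hs

theorem hasDerivAt_deriv_legendreFn (h₁ : -1 ≤ β) (h₂ : β ≤ 2) (ht : t ∈ Ioo (-1 : ℝ) 3) :
    HasDerivAt (deriv (legendreFn β)) (deriv (deriv (legendreFn β)) t) t :=
  (hasDerivAt_deriv_legendreFn_series h₁ h₂ ht).differentiableAt.hasDerivAt

/-- Legendre's differential equation. -/
theorem legendreFn_ode (h₁ : -1 ≤ β) (h₂ : β ≤ 2) (ht : t ∈ Ioo (-1 : ℝ) 3) :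
    (1 - t ^ 2) * deriv (deriv (legendreFn β)) t - 2 * t * deriv (legendreFn β) t
      + β * legendreFn β t = 0 := by
  have := legendreFn_ode_series h₁ h₂ (abs_one_sub_lt ht)
  rw [(hasDerivAt_deriv_legendreFn_series h₁ h₂ ht).deriv, deriv_legendreFn h₁ h₂ ht,
    legendreFn_eq_powSum]
  linear_combination this

theorem hasDerivAt_legendreFn_flux (h₁ : -1 ≤ β) (h₂ : β ≤ 2) (ht : t ∈ Ioo (-1 : ℝ) 3) :
    HasDerivAt (fun s => (1 - s ^ 2) * deriv (legendreFn β) s) (-β * legendreFn β t) t := by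
  have h := (((hasDerivAt_id t).pow 2).const_sub 1).mul (hasDerivAt_deriv_legendreFn h₁ h₂ ht)
  refine h.congr_deriv ?_
  have := legendreFn_ode h₁ h₂ ht
  simp only [id, Pi.pow_apply]
  push_cast
  linear_combination this

theorem contDiffOn_legendreFn (h₁ : -1 ≤ β) (h₂ : β ≤ 2) (n : ℕ) :
    ContDiffOn ℝ n (legendreFn β) (Ioo (-1) 3) := by
  rw [legendreFn_eq_powSum]
  refine ((polyGeo_legendreCoeff h₁ h₂).contDiffOn n).comp (by fun_prop) fun t ht => ?_
  exact abs_lt.1 (abs_one_sub_lt ht)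

theorem legendreFn_one (β : ℝ) : legendreFn β 1 = 1 := by
  rw [legendreFn, tsum_eq_single 0]
  · simp [legendreCoeff_zero]
  · intro n hn; simp [hn]

theorem legendreCoeff_nonneg (hβ : β ≤ 0) (n : ℕ) : 0 ≤ legendreCoeff β n := by
  induction n with
  | zero => simp [legendreCoeff_zero]
  | succ n ih =>
    rw [legendreCoeff_succ]
    refine mul_nonneg (by positivity) (div_nonneg ?_ (by positivity))
    have : (0 : ℝ) ≤ (n : ℝ) ^ 2 + n := by positivity
    linarith

/-- The sign is set by a₁ = -β/2; afterwards n² + n - β ≥ 0 preserves it. Hence P is increasing and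
concave on (-1, 1] for 0 < β ≤ 2. -/
theorem legendreCoeff_succ_nonpos (hβ : 0 ≤ β) (h₂ : β ≤ 2) (n : ℕ) :
    legendreCoeff β (n + 1) ≤ 0 := by
  induction n with
  | zero => rw [zero_add, legendreCoeff_one]; linarith
  | succ n ih =>
    rw [legendreCoeff_succ]
    refine mul_nonpos_of_nonpos_of_nonneg (by linarith) (div_nonneg ?_ (by positivity))
    have : (0 : ℝ) ≤ n := by positivity
    push_cast
    nlinarith

theorem powSum_neg (a : ℕ → ℝ) (x : ℝ) : powSum (fun n => -a n) x = -powSum a x := by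
  simp [powSum, tsum_neg]

/-- One-sided truncation: the discarded tail has constant sign, so partial sums are rigorous bounds.
-/
theorem PolyGeo.sum_range_le_powSum {a : ℕ → ℝ} (ha : PolyGeo a) {x : ℝ} (hx : 0 ≤ x)
    (hx2 : x < 2) (N : ℕ) (h : ∀ n, N ≤ n → 0 ≤ a n) :
    ∑ n ∈ Finset.range N, a n * x ^ n ≤ powSum a x :=
  (ha.summable (by rwa [abs_of_nonneg hx])).sum_le_tsum _ fun n hn =>
    mul_nonneg (h n (by simpa using hn)) (pow_nonneg hx n)

theorem PolyGeo.powSum_le_sum_range {a : ℕ → ℝ} (ha : PolyGeo a) {x : ℝ} (hx : 0 ≤ x)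
    (hx2 : x < 2) (N : ℕ) (h : ∀ n, N ≤ n → a n ≤ 0) :
    powSum a x ≤ ∑ n ∈ Finset.range N, a n * x ^ n := by
  have hneg : PolyGeo fun n => -a n := by simpa [PolyGeo] using ha
  have := hneg.sum_range_le_powSum hx hx2 N fun n hn => neg_nonneg.2 (h n hn)
  simp only [neg_mul, Finset.sum_neg_distrib, powSum_neg] at this
  linarith

theorem mem_Ioo_of_mem_Ioc (ht : t ∈ Ioc (-1 : ℝ) 1) : t ∈ Ioo (-1 : ℝ) 3 :=
  ⟨ht.1, by linarith [ht.2]⟩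

theorem one_le_legendreFn (h₁ : -1 ≤ β) (hβ : β ≤ 0) (ht : t ∈ Ioc (-1 : ℝ) 1) :
    1 ≤ legendreFn β t := by
  have := (polyGeo_legendreCoeff h₁ (by linarith)).sum_range_le_powSum (x := 1 - t)
    (by linarith [ht.2]) (by linarith [ht.1]) 1 fun n _ => legendreCoeff_nonneg hβ n
  rw [legendreFn_eq_powSum]
  simpa [legendreCoeff_zero] using this

theorem deriv_legendreFn_le (h₁ : -1 ≤ β) (hβ : β ≤ 0) (ht : t ∈ Ioc (-1 : ℝ) 1) :
    deriv (legendreFn β) t ≤ β / 2 := by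
  have := (polyGeo_legendreCoeff h₁ (by linarith)).derivCoeff.sum_range_le_powSum (x := 1 - t)
    (by linarith [ht.2]) (by linarith [ht.1]) 1
    fun n _ => mul_nonneg (by positivity) (legendreCoeff_nonneg hβ (n + 1))
  rw [deriv_legendreFn h₁ (by linarith) (mem_Ioo_of_mem_Ioc ht)]
  simp [derivCoeff, legendreCoeff_one] at this
  linarith

theorem legendreFn_le (hβ : 0 ≤ β) (h₂ : β ≤ 2) (ht : t ∈ Ioc (-1 : ℝ) 1) :
    legendreFn β t ≤ 1 - β / 2 * (1 - t) := by
  have := (polyGeo_legendreCoeff (by linarith) h₂).powSum_le_sum_range (x := 1 - t)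
    (by linarith [ht.2]) (by linarith [ht.1]) 2 fun n hn => by
      obtain ⟨m, rfl⟩ := Nat.exists_eq_add_of_le' (one_le_two.trans hn)
      exact legendreCoeff_succ_nonpos hβ h₂ m
  simp [Finset.sum_range_succ, legendreCoeff_zero, legendreCoeff_one] at this
  rw [legendreFn_eq_powSum]
  simp only
  linarith

theorem le_deriv_legendreFn (hβ : 0 ≤ β) (h₂ : β ≤ 2) (ht : t ∈ Ioc (-1 : ℝ) 1) :
    β / 2 ≤ deriv (legendreFn β) t := by
  have := (polyGeo_legendreCoeff (by linarith) h₂).derivCoeff.powSum_le_sum_range (x := 1 - t)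
    (by linarith [ht.2]) (by linarith [ht.1]) 1
    fun n _ => mul_nonpos_of_nonneg_of_nonpos (by positivity) (legendreCoeff_succ_nonpos hβ h₂ n)
  rw [deriv_legendreFn (by linarith) h₂ (mem_Ioo_of_mem_Ioc ht)]
  simp [derivCoeff, legendreCoeff_one] at this
  linarith

theorem deriv_deriv_legendreFn_nonpos (hβ : 0 ≤ β) (h₂ : β ≤ 2) (ht : t ∈ Ioc (-1 : ℝ) 1) :
    deriv (deriv (legendreFn β)) t ≤ 0 := by
  have := (polyGeo_legendreCoeff (by linarith) h₂).derivCoeff.derivCoeff.powSum_le_sum_range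
    (x := 1 - t) (by linarith [ht.2]) (by linarith [ht.1]) 0
    fun n _ => mul_nonpos_of_nonneg_of_nonpos (by positivity)
      (mul_nonpos_of_nonneg_of_nonpos (by positivity) (legendreCoeff_succ_nonpos hβ h₂ (n + 1)))
  rw [(hasDerivAt_deriv_legendreFn_series (by linarith) h₂ (mem_Ioo_of_mem_Ioc ht)).deriv]
  simpa using this

/-- The function `t g + (1 - t²) (-g')` for a Legendre function `g`, bounded from below by partial
sums of its expansion in powers of `1 - t`. -/
theorem sum_range_le_legendreFn (h₁ : -1 ≤ β) (hβ : β ≤ 0) (ht : t ∈ Ioc (-1 : ℝ) 1) {N : ℕ}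
    (hN : -t ≤ N * (1 + t)) :
    ∑ n ∈ Finset.range N, legendreCoeff β n * (1 - t) ^ n * (n * (1 + t) + t) ≤
      t * legendreFn β t - (1 - t ^ 2) * deriv (legendreFn β) t := by
  have ha := polyGeo_legendreCoeff h₁ (by linarith)
  have hx := abs_one_sub_lt (mem_Ioo_of_mem_Ioc ht)
  have s0 := (ha.summable hx).hasSum
  have s1 := hasSum_mul_shiftCoeff (ha.derivCoeff.summable hx).hasSum
  -- Since 1 - t² = (1 + t)(1 - t), the factor 1 - t restores the power lost in g', and the n-th
  -- term acquires the weight n(1 + t) + t. The hypothesis on N makes this weight nonnegative for n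
  -- ≥ N.
  have key := (s1.mul_left (1 + t)).add (s0.mul_left t)
  have e : (fun n : ℕ => (1 + t) * (shiftCoeff (derivCoeff (legendreCoeff β)) n * (1 - t) ^ n)
      + t * (legendreCoeff β n * (1 - t) ^ n)) =
      fun n : ℕ => legendreCoeff β n * (1 - t) ^ n * (n * (1 + t) + t) := by
    funext n
    rcases n with _ | n
    · simp [shiftCoeff]; ring
    · simp only [shiftCoeff, derivCoeff]; push_cast; ring
  rw [e] at key
  refine (sum_le_hasSum _ (fun n hn => ?_) key).trans (le_of_eq ?_)
  · have h1 : (N : ℝ) ≤ n := by exact_mod_cast not_lt.1 fun h => hn (Finset.mem_range.2 h)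
    have h2 : (N : ℝ) * (1 + t) ≤ n * (1 + t) :=
      mul_le_mul_of_nonneg_right h1 (by linarith [ht.1])
    exact mul_nonneg (mul_nonneg (legendreCoeff_nonneg hβ n)
      (pow_nonneg (by linarith [ht.2]) n)) (by linarith)
  · rw [deriv_legendreFn h₁ (by linarith) (mem_Ioo_of_mem_Ioc ht)]
    simp only [powSum, legendreFn]
    ring

/-- Here 0.7429 is a lower bound for κ when c ≤ 0.58828. The point t = -0.2039 lies to the left of
the zero for this κ, yet far enough to the right for Q to be nonnegative there, as the next lemma
shows. -/
theorem legendreFn_numeric_nonpos : legendreFn (2 * (7429 / 10000)) (1 - 12039 / 10000) ≤ 0 := by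
  have h := (polyGeo_legendreCoeff (β := 2 * (7429 / 10000)) (by norm_num)
    (by norm_num)).powSum_le_sum_range (x := 12039 / 10000)
    (by norm_num) (by norm_num) 20 fun n hn => by
      obtain ⟨m, rfl⟩ := Nat.exists_eq_add_of_le' ((by norm_num : 1 ≤ 20).trans hn)
      exact legendreCoeff_succ_nonpos (by norm_num) (by norm_num) m
  rw [legendreFn_eq_powSum]
  simp only [sub_sub_cancel]
  refine h.trans ?_
  norm_num [Finset.sum_range_succ, legendreCoeff]

theorem legendreFn_numeric_nonneg :
    0 ≤ (1 - 12039 / 10000) * legendreFn (-(7429 / 10000) / 4) (1 - 12039 / 10000)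
      - (1 - (1 - 12039 / 10000) ^ 2) *
        deriv (legendreFn (-(7429 / 10000) / 4)) (1 - 12039 / 10000) := by
  refine le_trans ?_ (sum_range_le_legendreFn (N := 20) (by norm_num) (by norm_num)
    (by constructor <;> norm_num) (by norm_num))
  norm_num [Finset.sum_range_succ, legendreCoeff]

end Legendre

/-! ### Sturm comparison and the key inequality -/

section Sturm

variable {β β₁ β₂ κ κ₁ t tc : ℝ}

/-- The weighted Wronskian vanishes at t = 1 because of the factor 1 - s². Comparisons in the
parameter therefore need no boundary condition beyond regularity there. -/
theorem legendreFn_wronskian (h₁ : -1 ≤ β₁) (h₁' : β₁ ≤ 2) (h₂ : -1 ≤ β₂) (h₂' : β₂ ≤ 2)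
    (ht : t ∈ Ioo (-1 : ℝ) 3) :
    HasDerivAt (fun s => (1 - s ^ 2) * deriv (legendreFn β₁) s * legendreFn β₂ s
        - legendreFn β₁ s * ((1 - s ^ 2) * deriv (legendreFn β₂) s))
      ((β₂ - β₁) * (legendreFn β₁ t * legendreFn β₂ t)) t := by
  have := ((hasDerivAt_legendreFn_flux h₁ h₁' ht).mul (hasDerivAt_legendreFn h₂ h₂' ht)).sub
    ((hasDerivAt_legendreFn h₁ h₁' ht).mul (hasDerivAt_legendreFn_flux h₂ h₂' ht))
  exact this.congr_deriv (by ring)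

theorem Icc_subset_Ioc_neg_one {b : ℝ} (h : -1 < t) (hb : b ≤ 1) : Icc t b ⊆ Ioc (-1 : ℝ) 1 :=
  fun _ hs => ⟨h.trans_le hs.1, hs.2.trans hb⟩

theorem continuousOn_legendreFn (h₁ : -1 ≤ β) (h₂ : β ≤ 2) :
    ContinuousOn (legendreFn β) (Ioc (-1) 1) := fun _ hs =>
  (hasDerivAt_legendreFn h₁ h₂ (mem_Ioo_of_mem_Ioc hs)).continuousAt.continuousWithinAt

theorem strictMonoOn_legendreFn (hβ : 0 < β) (h₂ : β ≤ 2) :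
    StrictMonoOn (legendreFn β) (Ioc (-1) 1) := by
  refine strictMonoOn_of_deriv_pos (convex_Ioc _ _)
    (continuousOn_legendreFn (by linarith) h₂) fun s hs => ?_
  have := le_deriv_legendreFn hβ.le h₂ (interior_subset hs)
  linarith

theorem antitoneOn_deriv_legendreFn (hβ : 0 ≤ β) (h₂ : β ≤ 2) :
    AntitoneOn (deriv (legendreFn β)) (Ioc (-1) 1) := by
  refine antitoneOn_of_deriv_nonpos (convex_Ioc _ _) (fun s hs => ?_) (fun s hs => ?_)
    fun s hs => deriv_deriv_legendreFn_nonpos hβ h₂ (interior_subset hs)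
  · exact (hasDerivAt_deriv_legendreFn (by linarith) h₂
      (mem_Ioo_of_mem_Ioc hs)).continuousAt.continuousWithinAt
  · exact (hasDerivAt_deriv_legendreFn (by linarith) h₂
      (mem_Ioo_of_mem_Ioc (interior_subset hs))).differentiableAt.differentiableWithinAt

theorem exists_legendreFn_zero (hκ : 7429 / 10000 ≤ κ) (hκ' : κ ≤ 1) :
    ∃ tc ∈ Ioo (-1 : ℝ) 1, ∀ t ∈ Ioc (-1 : ℝ) 1, legendreFn (2 * κ) t = 0 ↔ t = tc := by
  -- The tangent bound f ≤ 1 - κ(1 - t) is negative at t = -2/5, because κ · 7/5 > 1.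
  have hneg : legendreFn (2 * κ) (-(2 / 5)) < 0 := by
    have := legendreFn_le (β := 2 * κ) (t := -(2 / 5)) (by linarith) (by linarith)
      (by constructor <;> norm_num)
    linarith
  obtain ⟨tc, htc, h0⟩ := intermediate_value_Icc (a := (-(2 / 5) : ℝ)) (b := 1) (by norm_num)
    ((continuousOn_legendreFn (β := 2 * κ) (by linarith) (by linarith)).mono
      (Icc_subset_Ioc_neg_one (by norm_num) le_rfl))
    (show (0 : ℝ) ∈ Icc _ _ from ⟨hneg.le, by rw [legendreFn_one]; norm_num⟩)
  have hlt : tc < 1 := lt_of_le_of_ne htc.2 fun h => by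
    rw [h, legendreFn_one] at h0; norm_num at h0
  have hgt : -1 < tc := by linarith [htc.1]
  refine ⟨tc, ⟨hgt, hlt⟩, fun t ht => ⟨fun h => ?_, fun h => h ▸ h0⟩⟩
  exact (strictMonoOn_legendreFn (by linarith) (by linarith)).injOn ht ⟨hgt, hlt.le⟩ (h.trans h0.symm)

/-- The zero of `legendreFn β₁` moves to the right when the parameter increases. -/
theorem legendreFn_nonpos_of_le (h₁ : 0 < β₁) (h : β₁ ≤ β₂) (h₂ : β₂ ≤ 2)
    {t₀ : ℝ} (ht₀ : t₀ ∈ Ioo (-1 : ℝ) 1) (h0 : legendreFn β₁ t₀ = 0)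
    (ht : t ∈ Ioc (-1 : ℝ) t₀) : legendreFn β₂ t ≤ 0 := by
  have m₁ := strictMonoOn_legendreFn h₁ (h.trans h₂)
  have m₂ := strictMonoOn_legendreFn (h₁.trans_le h) h₂
  have ht₀' : t₀ ∈ Ioc (-1 : ℝ) 1 := ⟨ht₀.1, ht₀.2.le⟩
  by_contra! hpos
  have hpos' : 0 < legendreFn β₂ t₀ := hpos.trans_le
    (m₂.monotoneOn ⟨ht.1, ht.2.trans ht₀.2.le⟩ ht₀' ht.2)
  -- If the second function were positive at t₀, both would be nonnegative on [t₀, 1]. The Wronskian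
  -- would then decrease to 0, although it is negative at t₀.
  have hW : ∀ s ∈ Icc t₀ 1, _ := fun s hs => legendreFn_wronskian (β₁ := β₂) (β₂ := β₁) (t := s)
    (by linarith) h₂ (by linarith) (h.trans h₂)
    (mem_Ioo_of_mem_Ioc (Icc_subset_Ioc_neg_one ht₀.1 le_rfl hs))
  have hanti := antitoneOn_of_deriv_nonpos (convex_Icc t₀ 1)
    (fun s hs => (hW s hs).continuousAt.continuousWithinAt)
    (fun s hs => (hW s (interior_subset hs)).differentiableAt.differentiableWithinAt)
    (fun s hs => by
      have hs' := interior_subset hs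
      have hs1 := Icc_subset_Ioc_neg_one ht₀.1 le_rfl hs'
      rw [(hW s hs').deriv]
      have a₁ := m₁.monotoneOn ht₀' hs1 hs'.1
      have a₂ := m₂.monotoneOn ht₀' hs1 hs'.1
      exact mul_nonpos_of_nonpos_of_nonneg (by linarith)
        (mul_nonneg (by linarith) (by linarith)))
  have hle := hanti (left_mem_Icc.2 ht₀.2.le) (right_mem_Icc.2 ht₀.2.le) ht₀.2.le
  have hd := le_deriv_legendreFn h₁.le (h.trans h₂) ht₀'
  simp only [h0, legendreFn_one] at hle
  have h3 : 0 < legendreFn β₂ t₀ * ((1 - t₀ ^ 2) * deriv (legendreFn β₁) t₀) :=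
    mul_pos hpos' (mul_pos (by nlinarith [ht₀.1, ht₀.2]) (by linarith))
  linarith

/-- The logarithmic derivative of `legendreFn β`, `β ≤ 0`, is monotone in `β`. -/
theorem deriv_div_legendreFn_le (h₂ : -1 ≤ β₂) (h : β₂ ≤ β₁) (h₁ : β₁ ≤ 0)
    (ht : t ∈ Ioc (-1 : ℝ) 1) :
    (1 - t ^ 2) * (deriv (legendreFn β₂) t / legendreFn β₂ t) ≤
      (1 - t ^ 2) * (deriv (legendreFn β₁) t / legendreFn β₁ t) := by
  -- Both functions are at least 1, so the Wronskian increases to its value 0 at s = 1 and is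
  -- nonpositive before.
  have hW : ∀ s ∈ Icc t 1, _ := fun s hs => legendreFn_wronskian (β₁ := β₂) (β₂ := β₁) (t := s)
    h₂ (by linarith) (by linarith) (by linarith)
    (mem_Ioo_of_mem_Ioc (Icc_subset_Ioc_neg_one ht.1 le_rfl hs))
  have hmono := monotoneOn_of_deriv_nonneg (convex_Icc t 1)
    (fun s hs => (hW s hs).continuousAt.continuousWithinAt)
    (fun s hs => (hW s (interior_subset hs)).differentiableAt.differentiableWithinAt)
    (fun s hs => by
      have hs' := interior_subset hs
      have hs1 := Icc_subset_Ioc_neg_one ht.1 le_rfl hs'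
      rw [(hW s hs').deriv]
      have a₁ := one_le_legendreFn (by linarith) h₁ hs1
      have a₂ := one_le_legendreFn h₂ (by linarith) hs1
      exact mul_nonneg (by linarith) (mul_nonneg (by linarith) (by linarith)))
  have hle := hmono (left_mem_Icc.2 ht.2) (right_mem_Icc.2 ht.2) ht.2
  have a₁ := one_le_legendreFn (by linarith) h₁ ht
  have a₂ := one_le_legendreFn h₂ (by linarith) ht
  rw [← mul_div_assoc, ← mul_div_assoc, div_le_div_iff₀ (by linarith) (by linarith)]
  norm_num at hle
  linarith

/-- `t - (1 - t²) g'/g` for the Legendre function `g` with parameter `-κ/4`. -/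
noncomputable def slopeFn (κ t : ℝ) : ℝ :=
  t - (1 - t ^ 2) * (deriv (legendreFn (-κ / 4)) t / legendreFn (-κ / 4) t)

/-- This is the Riccati equation ((1-t²)H)' = κ/4 - (1-t²)H², obtained by dividing the equation of g
by g. -/
theorem hasDerivAt_slopeFn (h₀ : 0 ≤ κ) (h₁ : κ ≤ 1) (ht : t ∈ Ioc (-1 : ℝ) 1) :
    HasDerivAt (slopeFn κ) (1 - κ / 4 +
      (1 - t ^ 2) * (deriv (legendreFn (-κ / 4)) t / legendreFn (-κ / 4) t) ^ 2) t := by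
  have hg := one_le_legendreFn (β := -κ / 4) (by linarith) (by linarith) ht
  have hg0 : legendreFn (-κ / 4) t ≠ 0 := by linarith
  have ht' := mem_Ioo_of_mem_Ioc ht
  have := (hasDerivAt_id t).sub ((hasDerivAt_legendreFn_flux (β := -κ / 4) (by linarith)
    (by linarith) ht').div (hasDerivAt_legendreFn (by linarith) (by linarith) ht') hg0)
  have e : slopeFn κ = id - (fun s => (1 - s ^ 2) * deriv (legendreFn (-κ / 4)) s) /
      legendreFn (-κ / 4) := by
    funext s; simp [slopeFn, mul_div_assoc]
  rw [e]
  refine this.congr_deriv ?_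
  generalize legendreFn (-κ / 4) t = g at *
  field_simp
  ring

theorem three_fourths_mul_sub_le_slopeFn (h₀ : 0 ≤ κ) (h₁ : κ ≤ 1) {s : ℝ} (hs : -1 < s)
    (hst : s ≤ t) (ht : t ≤ 1) : 3 / 4 * (t - s) ≤ slopeFn κ t - slopeFn κ s := by
  have hd : ∀ x ∈ Icc s t, _ := fun x hx => hasDerivAt_slopeFn h₀ h₁
    (Icc_subset_Ioc_neg_one hs ht hx)
  refine (convex_Icc s t).mul_sub_le_image_sub_of_le_deriv
    (fun x hx => (hd x hx).continuousAt.continuousWithinAt)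
    (fun x hx => (hd x (interior_subset hx)).differentiableAt.differentiableWithinAt)
    (fun x hx => ?_) s (left_mem_Icc.2 hst) t (right_mem_Icc.2 hst) hst
  have hx' := interior_subset hx
  rw [(hd x hx').deriv]
  have hx1 := Icc_subset_Ioc_neg_one hs ht hx'
  have : 0 ≤ (1 - x ^ 2) * (deriv (legendreFn (-κ / 4)) x / legendreFn (-κ / 4) x) ^ 2 :=
    mul_nonneg (by nlinarith [hx1.1, hx1.2]) (sq_nonneg _)
  linarith

theorem slopeFn_numeric_nonneg : 0 ≤ slopeFn (7429 / 10000) (1 - 12039 / 10000) := by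
  have hg := one_le_legendreFn (β := -(7429 / 10000) / 4) (t := 1 - 12039 / 10000) (by norm_num)
    (by norm_num) (by constructor <;> norm_num)
  have h := legendreFn_numeric_nonneg
  rw [slopeFn, ← mul_div_assoc, sub_nonneg, div_le_iff₀ (by linarith)]
  linarith

/-- The zero moves to the right as κ grows, so the numerical bound at the smallest κ serves for all.
-/
theorem le_legendreFn_zero (hκ : 7429 / 10000 ≤ κ) (hκ' : κ ≤ 1) (htc : tc ∈ Ioo (-1 : ℝ) 1)
    (h0 : legendreFn (2 * κ) tc = 0) : 1 - 12039 / 10000 ≤ tc := by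
  obtain ⟨t₀, ht₀, h⟩ := exists_legendreFn_zero (κ := 7429 / 10000) le_rfl (by norm_num)
  have hT : (1 - 12039 / 10000 : ℝ) ∈ Ioc (-1 : ℝ) 1 := by constructor <;> norm_num
  have ht₀' : t₀ ∈ Ioc (-1 : ℝ) 1 := ⟨ht₀.1, ht₀.2.le⟩
  have hz := (h t₀ ht₀').2 rfl
  have hle : (1 - 12039 / 10000 : ℝ) ≤ t₀ := by
    refine (strictMonoOn_legendreFn (β := 2 * (7429 / 10000)) (by norm_num)
      (by norm_num)).le_iff_le hT ht₀' |>.1 ?_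
    rw [hz]
    exact legendreFn_numeric_nonpos
  refine (strictMonoOn_legendreFn (β := 2 * κ) (by linarith) (by linarith)).le_iff_le hT
    ⟨htc.1, htc.2.le⟩ |>.1 ?_
  rw [h0]
  exact legendreFn_nonpos_of_le (by norm_num) (by linarith) (by linarith) ht₀ hz ⟨hT.1, hle⟩

/-- Q increases with κ, because H decreases, and it increases with t. Starting from κ = 0.7429 and t
= -0.2039, both moves go upward. -/
theorem slopeFn_nonneg_of_zero (hκ : 7429 / 10000 ≤ κ) (hκ' : κ ≤ 1) (htc : tc ∈ Ioo (-1 : ℝ) 1)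
    (h0 : legendreFn (2 * κ) tc = 0) : 0 ≤ slopeFn κ tc := by
  have hle := le_legendreFn_zero hκ hκ' htc h0
  have h1 := three_fourths_mul_sub_le_slopeFn (κ := κ) (by linarith) hκ' (by norm_num) hle htc.2.le
  have h2 := deriv_div_legendreFn_le (β₁ := -(7429 / 10000) / 4) (β₂ := -κ / 4)
    (t := 1 - 12039 / 10000) (by linarith) (by linarith) (by norm_num)
    (by constructor <;> norm_num)
  have h3 := slopeFn_numeric_nonneg
  rw [slopeFn] at h3
  have h4 : 0 ≤ slopeFn κ (1 - 12039 / 10000) := by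
    rw [slopeFn]; linarith
  linarith

/-- Integrating ((1-s²)f')' = -2κf from t_c to 1 with f ≤ 1 - κ(1-s) gives (1 + t_c) D ≤ κ(2 - κ(1 -
t_c)). -/
theorem deriv_legendreFn_zero_lt (hκ : 7429 / 10000 ≤ κ) (hκ' : κ ≤ 1)
    (htc : tc ∈ Ioo (-1 : ℝ) 1) (h0 : legendreFn (2 * κ) tc = 0) :
    deriv (legendreFn (2 * κ)) tc < 4 / 3 := by
  have hle := le_legendreFn_zero hκ hκ' htc h0
  have hM : ∀ s ∈ Icc tc 1, HasDerivAt
      (fun s => κ * (1 - s) * (2 - κ * (1 - s)) - (1 - s ^ 2) * deriv (legendreFn (2 * κ)) s)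
      (-(2 * κ) * (1 - κ * (1 - s) - legendreFn (2 * κ) s)) s := fun s hs => by
    have h1 : HasDerivAt (fun s : ℝ => 1 - s) (-1) s := by
      simpa using (hasDerivAt_id s).const_sub 1
    have := ((h1.const_mul κ).mul ((h1.const_mul κ).const_sub 2)).sub
      (hasDerivAt_legendreFn_flux (β := 2 * κ) (by linarith) (by linarith)
        (mem_Ioo_of_mem_Ioc (Icc_subset_Ioc_neg_one htc.1 le_rfl hs)))
    exact this.congr_deriv (by ring)
  have hanti := antitoneOn_of_deriv_nonpos (convex_Icc tc 1)
    (fun s hs => (hM s hs).continuousAt.continuousWithinAt)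
    (fun s hs => (hM s (interior_subset hs)).differentiableAt.differentiableWithinAt)
    (fun s hs => by
      have hs' := interior_subset hs
      rw [(hM s hs').deriv]
      have := legendreFn_le (β := 2 * κ) (by linarith) (by linarith)
        (Icc_subset_Ioc_neg_one htc.1 le_rfl hs')
      exact mul_nonpos_of_nonpos_of_nonneg (by linarith) (by linarith))
  have h := hanti (left_mem_Icc.2 htc.2.le) (right_mem_Icc.2 htc.2.le) htc.2.le
  norm_num at h
  set D := deriv (legendreFn (2 * κ)) tc
  have hs : 0 < 1 - tc := by linarith [htc.2]
  have h' : (1 + tc) * D ≤ κ * (2 - κ * (1 - tc)) := by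
    refine le_of_mul_le_mul_left ?_ hs
    linarith
  have hp : 0 < 1 + tc := by linarith [htc.1]
  -- Since κ² < 4/3, the worst case is the smallest admissible t_c, namely -0.2039. The remaining
  -- quadratic in κ has its maximum near κ = 0.83, and this maximum is negative.
  have h2 : κ * (2 - κ * (1 - tc)) < (1 + tc) * (4 / 3) := by
    nlinarith [sq_nonneg (κ - 0.83), mul_nonneg (by linarith : 0 ≤ 1 - κ) (by linarith : 0 ≤ 1 + κ)]
  exact lt_of_mul_lt_mul_left (h'.trans_lt h2) hp.le

/-- The expression that is `G_c'` up to the factor `a²`. -/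
theorem legendreFn_gradient_deriv_pos (hκ : 7429 / 10000 ≤ κ) (hκ' : κ ≤ 1)
    (htc : tc ∈ Ioo (-1 : ℝ) 1) (h0 : legendreFn (2 * κ) tc = 0) (ht : t ∈ Ioo tc 1) :
    0 < 9 / 2 * κ * legendreFn (2 * κ) t ^ 2 *
        (deriv (legendreFn (-κ / 4)) t / legendreFn (-κ / 4) t) +
      2 * (deriv (legendreFn (2 * κ)) t - legendreFn (2 * κ) t *
        (deriv (legendreFn (-κ / 4)) t / legendreFn (-κ / 4) t)) ^ 2 * slopeFn κ t := by
  have htc' : tc ∈ Ioc (-1 : ℝ) 1 := ⟨htc.1, htc.2.le⟩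
  have ht' : t ∈ Ioc (-1 : ℝ) 1 := ⟨htc.1.trans ht.1, ht.2.le⟩
  have hQ := three_fourths_mul_sub_le_slopeFn (κ := κ) (by linarith) hκ' htc.1 ht.1.le ht.2.le
  have hQ0 := slopeFn_nonneg_of_zero hκ hκ' htc h0
  have hD := deriv_legendreFn_zero_lt hκ hκ' htc h0
  have hf : 0 < legendreFn (2 * κ) t := h0 ▸
    strictMonoOn_legendreFn (β := 2 * κ) (by linarith) (by linarith) htc' ht' ht.1
  have hf' := le_deriv_legendreFn (β := 2 * κ) (by linarith) (by linarith) ht'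
  have hconc : legendreFn (2 * κ) t - legendreFn (2 * κ) tc ≤
      deriv (legendreFn (2 * κ)) tc * (t - tc) := by
    have hd : ∀ x ∈ Icc tc t, _ := fun x hx => hasDerivAt_legendreFn (β := 2 * κ) (by linarith)
      (by linarith) (mem_Ioo_of_mem_Ioc (Icc_subset_Ioc_neg_one htc.1 ht.2.le hx))
    exact (convex_Icc tc t).image_sub_le_mul_sub_of_deriv_le
      (fun x hx => (hd x hx).continuousAt.continuousWithinAt)
      (fun x hx => (hd x (interior_subset hx)).differentiableAt.differentiableWithinAt)
      (fun x hx => antitoneOn_deriv_legendreFn (by linarith) (by linarith) htc'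
        (Icc_subset_Ioc_neg_one htc.1 ht.2.le (interior_subset hx)) (interior_subset hx).1)
      tc (left_mem_Icc.2 ht.1.le) t (right_mem_Icc.2 ht.1.le) ht.1.le
  rw [h0, sub_zero] at hconc
  have hg := one_le_legendreFn (β := -κ / 4) (by linarith) (by linarith) ht'
  have hg' := deriv_legendreFn_le (β := -κ / 4) (by linarith) (by linarith) ht'
  have hH : deriv (legendreFn (-κ / 4)) t / legendreFn (-κ / 4) t ≤ 0 :=
    div_nonpos_of_nonpos_of_nonneg (by linarith) (by linarith)
  set f := legendreFn (2 * κ) t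
  set f' := deriv (legendreFn (2 * κ)) t
  set D := deriv (legendreFn (2 * κ)) tc
  set H := deriv (legendreFn (-κ / 4)) t / legendreFn (-κ / 4) t
  have hfH : 0 ≤ f * -H := mul_nonneg hf.le (by linarith)
  have hw : 0 < f' - f * H := by linarith
  have hw2 : 0 < (f' - f * H) ^ 2 := by positivity
  have hd : 0 < t - tc := by linarith [ht.1]
  -- AM-GM in the form (f' - fH)² - 4f'·f(-H) = (f' + fH)², together with f' ≥ κ.
  have e1 : 4 * κ * (f * -H) ≤ (f' - f * H) ^ 2 := by
    have : κ * (f * -H) ≤ f' * (f * -H) := mul_le_mul_of_nonneg_right (by linarith) hfH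
    nlinarith [sq_nonneg (f' + f * H)]
  -- The constants balance: (9/2)·(1/4)·(4/3) = 3/2 = 2·(3/4). Strictness comes only from D < 4/3.
  have e2 : f * (κ * (f * -H)) ≤ D * (t - tc) * (κ * (f * -H)) :=
    mul_le_mul_of_nonneg_right hconc (mul_nonneg (by linarith) hfH)
  have e3 : D * (t - tc) * (4 * κ * (f * -H)) ≤ D * (t - tc) * (f' - f * H) ^ 2 :=
    mul_le_mul_of_nonneg_left e1 (hf.le.trans hconc)
  have e4 : D * ((t - tc) * (f' - f * H) ^ 2) < 4 / 3 * ((t - tc) * (f' - f * H) ^ 2) :=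
    mul_lt_mul_of_pos_right hD (by positivity)
  have e5 : (f' - f * H) ^ 2 * (3 / 4 * (t - tc)) ≤ (f' - f * H) ^ 2 * slopeFn κ t :=
    mul_le_mul_of_nonneg_left (by linarith) hw2.le
  linarith

end Sturm

/-! ### The derivative of G_c -/

section Gradient

variable {c a t : ℝ}

theorem fCone_param (c : ℝ) : 2 / (1 + c ^ 2) = 2 * (1 / (1 + c ^ 2)) := by ring

theorem gCone_param (c : ℝ) : -(1 / 4) / (1 + c ^ 2) = -(1 / (1 + c ^ 2)) / 4 := by ring

theorem one_div_one_add_sq_mem (c : ℝ) : 1 / (1 + c ^ 2) ∈ Ioc (0 : ℝ) 1 :=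
  ⟨by positivity, by rw [div_le_one (by positivity)]; nlinarith⟩

theorem deriv_fCone (c a : ℝ) : deriv (fCone c a) =
    fun t => a * deriv (legendreFn (2 * (1 / (1 + c ^ 2)))) t := by
  funext t
  have : fCone c a = fun t => a * legendreFn (2 * (1 / (1 + c ^ 2))) t := by
    funext t; rw [fCone, fCone_param]
  rw [this, deriv_const_mul_field]

theorem gCone_eq (c : ℝ) : gCone c = legendreFn (-(1 / (1 + c ^ 2)) / 4) := by
  funext t; rw [gCone, gCone_param]

theorem fCone_eq (c a : ℝ) : fCone c a = fun t => a * legendreFn (2 * (1 / (1 + c ^ 2))) t := by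
  funext t; rw [fCone, fCone_param]

theorem GCone_eq (c a : ℝ) : GCone c a = fun t =>
    a ^ 2 * (9 / 4 * (1 / (1 + c ^ 2)) * legendreFn (2 * (1 / (1 + c ^ 2))) t ^ 2 + (1 - t ^ 2) *
      (deriv (legendreFn (2 * (1 / (1 + c ^ 2)))) t - legendreFn (2 * (1 / (1 + c ^ 2))) t *
        (deriv (legendreFn (-(1 / (1 + c ^ 2)) / 4)) t /
          legendreFn (-(1 / (1 + c ^ 2)) / 4) t)) ^ 2) := by
  funext t
  rw [GCone, deriv_fCone, fCone_eq, gCone_eq]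
  ring

/-- With w = f' - fH, the equations give (1-t²)w' = 2tw - (9/4)κf - (1-t²)Hw, where 9/4 = 2 + 1/4.
The coefficient 9/4 in G_c then reduces the terms in f f' and f w to (9/2)κ f(f' - w) = (9/2)κ f² H.
-/
theorem hasDerivAt_GCone (ht : t ∈ Ioc (-1 : ℝ) 1) {κ : ℝ} (hκ : κ = 1 / (1 + c ^ 2)) :
    HasDerivAt (GCone c a) (a ^ 2 * (9 / 2 * κ * legendreFn (2 * κ) t ^ 2 *
        (deriv (legendreFn (-κ / 4)) t / legendreFn (-κ / 4) t) +
      2 * (deriv (legendreFn (2 * κ)) t - legendreFn (2 * κ) t *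
        (deriv (legendreFn (-κ / 4)) t / legendreFn (-κ / 4) t)) ^ 2 * slopeFn κ t)) t := by
  rw [GCone_eq, ← hκ]
  obtain ⟨hκ0, hκ1⟩ := hκ ▸ one_div_one_add_sq_mem c
  have ht' := mem_Ioo_of_mem_Ioc ht
  have hg := one_le_legendreFn (β := -κ / 4) (by linarith) (by linarith) ht
  have hg0 : legendreFn (-κ / 4) t ≠ 0 := by linarith
  have df := hasDerivAt_legendreFn (β := 2 * κ) (by linarith) (by linarith) ht'
  have ddf := hasDerivAt_deriv_legendreFn (β := 2 * κ) (by linarith) (by linarith) ht'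
  have dg := hasDerivAt_legendreFn (β := -κ / 4) (by linarith) (by linarith) ht'
  have ddg := hasDerivAt_deriv_legendreFn (β := -κ / 4) (by linarith) (by linarith) ht'
  have ef := legendreFn_ode (β := 2 * κ) (by linarith) (by linarith) ht'
  have eg := legendreFn_ode (β := -κ / 4) (by linarith) (by linarith) ht'
  have key := (((df.pow 2).const_mul (9 / 4 * κ)).add
    ((((hasDerivAt_id t).pow 2).const_sub 1).mul
      ((ddf.sub (df.mul (ddg.div dg hg0))).pow 2))).const_mul (a ^ 2)
  refine key.congr_deriv ?_
  simp only [slopeFn, Pi.sub_apply, Pi.mul_apply, Pi.div_apply, Pi.pow_apply, id]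
  push_cast
  generalize deriv (deriv (legendreFn (2 * κ))) t = f2 at *
  generalize deriv (deriv (legendreFn (-κ / 4))) t = g2 at *
  generalize deriv (legendreFn (2 * κ)) t = f1 at *
  generalize deriv (legendreFn (-κ / 4)) t = g1 at *
  generalize legendreFn (2 * κ) t = f at *
  generalize legendreFn (-κ / 4) t = g at *
  -- The Riccati equation solved for (1-t²)H'; it removes the second derivative of g.
  have eh : (1 - t ^ 2) * ((g2 * g - g1 * g1) / g ^ 2) =
      2 * t * (g1 / g) + κ / 4 - (1 - t ^ 2) * (g1 / g) ^ 2 := by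
    field_simp
    linear_combination 4 * g * eg
  generalize (g2 * g - g1 * g1) / g ^ 2 = h' at *
  generalize g1 / g = h at *
  linear_combination 2 * a ^ 2 * (f1 - f * h) * ef - 2 * a ^ 2 * (f1 - f * h) * f * eh

end Gradient

/-! ### Gradient and Laplacian of homogeneous functions on the cone -/

section Calculus

variable {F G : EuclideanSpace ℝ (Fin 3) → ℝ} {d e : Fin 3 → ℝ} {y : EuclideanSpace ℝ (Fin 3)}

/-- `F` is differentiable at `y` and its partial derivatives there are `d`. -/
def HasPartials (F : EuclideanSpace ℝ (Fin 3) → ℝ) (d : Fin 3 → ℝ)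
    (y : EuclideanSpace ℝ (Fin 3)) : Prop :=
  ∃ L : EuclideanSpace ℝ (Fin 3) →L[ℝ] ℝ, HasFDerivAt F L y ∧
    ∀ j, L (EuclideanSpace.single j 1) = d j

theorem HasPartials.partialD (h : HasPartials F d y) (j : Fin 3) : partialD j F y = d j := by
  obtain ⟨L, hL, hd⟩ := h
  rw [_root_.partialD, hL.fderiv, hd]

theorem HasPartials.continuousAt (h : HasPartials F d y) : ContinuousAt F y :=
  h.choose_spec.1.continuousAt

theorem HasPartials.congr (h : HasPartials F d y) (hG : G =ᶠ[𝓝 y] F) (he : ∀ j, d j = e j) :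
    HasPartials G e y := by
  obtain ⟨L, hL, hd⟩ := h
  exact ⟨L, hL.congr_of_eventuallyEq hG, fun j => (hd j).trans (he j)⟩

theorem HasPartials.add (hF : HasPartials F d y) (hG : HasPartials G e y) :
    HasPartials (fun z => F z + G z) (fun j => d j + e j) y := by
  obtain ⟨L, hL, hd⟩ := hF
  obtain ⟨M, hM, he⟩ := hG
  exact ⟨L + M, hL.add hM, fun j => by simp [hd, he]⟩

theorem HasPartials.sub (hF : HasPartials F d y) (hG : HasPartials G e y) :
    HasPartials (fun z => F z - G z) (fun j => d j - e j) y := by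
  obtain ⟨L, hL, hd⟩ := hF
  obtain ⟨M, hM, he⟩ := hG
  exact ⟨L - M, hL.sub hM, fun j => by simp [hd, he]⟩

theorem HasPartials.mul (hF : HasPartials F d y) (hG : HasPartials G e y) :
    HasPartials (fun z => F z * G z) (fun j => F y * e j + G y * d j) y := by
  obtain ⟨L, hL, hd⟩ := hF
  obtain ⟨M, hM, he⟩ := hG
  exact ⟨F y • M + G y • L, hL.mul hM, fun j => by simp [hd, he]⟩

theorem HasPartials.const_mul (b : ℝ) (hF : HasPartials F d y) :
    HasPartials (fun z => b * F z) (fun j => b * d j) y := by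
  obtain ⟨L, hL, hd⟩ := hF
  exact ⟨b • L, hL.const_mul b, fun j => by simp [hd]⟩

theorem HasPartials.comp {p : ℝ → ℝ} {p' : ℝ} (hp : HasDerivAt p p' (F y))
    (hF : HasPartials F d y) : HasPartials (fun z => p (F z)) (fun j => p' * d j) y := by
  obtain ⟨L, hL, hd⟩ := hF
  exact ⟨p' • L, hp.comp_hasFDerivAt y hL, fun j => by simp [hd]⟩

theorem hasPartials_coord (i : Fin 3) (y : EuclideanSpace ℝ (Fin 3)) :
    HasPartials (fun z => z i) (fun j => if j = i then 1 else 0) y :=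
  ⟨EuclideanSpace.proj i, (EuclideanSpace.proj i :
    EuclideanSpace ℝ (Fin 3) →L[ℝ] ℝ).hasFDerivAt, fun j => by simp [eq_comm]⟩

theorem hasPartials_norm (hy : y ≠ 0) :
    HasPartials (fun z => ‖z‖) (fun j => ‖y‖⁻¹ * y j) y := by
  have h1 := (hasStrictFDerivAt_norm_sq y).hasFDerivAt.sqrt (pow_ne_zero 2 (norm_ne_zero_iff.2 hy))
  simp only [Real.sqrt_sq (norm_nonneg _)] at h1
  refine ⟨_, h1, fun j => ?_⟩
  simp [EuclideanSpace.inner_single_right]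
  ring

theorem hasPartials_norm_inv (hy : y ≠ 0) :
    HasPartials (fun z => ‖z‖⁻¹) (fun j => -‖y‖⁻¹ ^ 3 * y j) y := by
  have := HasPartials.comp (hasDerivAt_inv (norm_ne_zero_iff.2 hy)) (hasPartials_norm hy)
  refine this.congr (Eventually.of_forall fun _ => rfl) fun j => ?_
  rw [← inv_pow]; ring

theorem hasPartials_norm_rpow (α : ℝ) (hy : y ≠ 0) :
    HasPartials (fun z => ‖z‖ ^ α) (fun j => α * ‖y‖ ^ α * ‖y‖⁻¹ ^ 2 * y j) y := by
  have hn : ‖y‖ ≠ 0 := norm_ne_zero_iff.2 hy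
  have := HasPartials.comp (Real.hasDerivAt_rpow_const (p := α) (Or.inl hn)) (hasPartials_norm hy)
  refine this.congr (Eventually.of_forall fun _ => rfl) fun j => ?_
  rw [Real.rpow_sub_one hn]
  field_simp

theorem norm_inv_sq_mul_sum (hy : y ≠ 0) :
    ‖y‖⁻¹ ^ 2 * (y 0 ^ 2 + y 1 ^ 2 + y 2 ^ 2) = 1 := by
  have h : ‖y‖ ^ 2 = y 0 ^ 2 + y 1 ^ 2 + y 2 ^ 2 := by
    rw [EuclideanSpace.real_norm_sq_eq, Fin.sum_univ_three]
  rw [← h, ← mul_pow, inv_mul_cancel₀ (norm_ne_zero_iff.2 hy), one_pow]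

/-- `cos φ = y₃ / |y|`. -/
noncomputable def cosAngle (y : EuclideanSpace ℝ (Fin 3)) : ℝ := y 2 / ‖y‖

theorem hasPartials_cosAngle (hy : y ≠ 0) :
    HasPartials cosAngle
      (fun j => (if j = 2 then 1 else 0) * ‖y‖⁻¹ - y 2 * y j * ‖y‖⁻¹ ^ 3) y := by
  refine ((hasPartials_coord 2 y).mul (hasPartials_norm_inv hy)).congr
    (Eventually.of_forall fun z => div_eq_mul_inv _ _) fun j => ?_
  ring

/-- The function `r^α p(cos φ)`, homogeneous of degree `α`. -/
noncomputable def homFn (α : ℝ) (p : ℝ → ℝ) (y : EuclideanSpace ℝ (Fin 3)) : ℝ :=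
  ‖y‖ ^ α * p (cosAngle y)

/-- The gradient of `r^α p(cos φ)`, where `q` is the derivative of `p`. -/
noncomputable def homGrad (α : ℝ) (p q : ℝ → ℝ) (y : EuclideanSpace ℝ (Fin 3)) (j : Fin 3) : ℝ :=
  ‖y‖ ^ α * (α * ‖y‖⁻¹ ^ 2 * y j * p (cosAngle y) +
    q (cosAngle y) * ((if j = 2 then 1 else 0) * ‖y‖⁻¹ - y 2 * y j * ‖y‖⁻¹ ^ 3))

theorem hasPartials_homFn {α : ℝ} {p q : ℝ → ℝ} (hy : y ≠ 0)
    (hp : HasDerivAt p (q (cosAngle y)) (cosAngle y)) :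
    HasPartials (homFn α p) (homGrad α p q y) y := by
  refine ((hasPartials_norm_rpow α hy).mul (HasPartials.comp hp (hasPartials_cosAngle hy))).congr
    (Eventually.of_forall fun z => rfl) fun j => ?_
  simp only [homGrad]
  ring

/-- Euler's identity: the gradient of cos φ is orthogonal to y. -/
theorem sum_mul_homGrad {α : ℝ} {p q : ℝ → ℝ} (hy : y ≠ 0) :
    ∑ i, y i * homGrad α p q y i = α * homFn α p y := by
  have hm := norm_inv_sq_mul_sum hy
  simp [Fin.sum_univ_three, homGrad, homFn]
  linear_combination (α * ‖y‖ ^ α * p (cosAngle y)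
    - ‖y‖ ^ α * q (cosAngle y) * y 2 * ‖y‖⁻¹) * hm

/-- The metric is I + c² n nᵀ with n = y/|y|. It stretches only the radial direction, so its inverse
multiplies that direction by κ = 1/(1+c²). -/
theorem coneMetric_inv (c : ℝ) (hy : y ≠ 0) :
    (coneMetric c y)⁻¹ = Matrix.of fun i j : Fin 3 =>
      (if i = j then 1 else 0) - (1 - 1 / (1 + c ^ 2)) * (y i * y j) * ‖y‖⁻¹ ^ 2 := by
  have hm := norm_inv_sq_mul_sum hy
  have hc : 1 + c ^ 2 ≠ 0 := by positivity
  refine Matrix.inv_eq_right_inv ?_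
  have hb : (1 - 1 / (1 + c ^ 2)) * (1 + c ^ 2) = c ^ 2 := by field_simp; ring
  generalize 1 - 1 / (1 + c ^ 2) = b at hb ⊢
  ext i j
  have hsum : ∑ k, y k * y k * ‖y‖⁻¹ ^ 2 = 1 := by
    rw [Fin.sum_univ_three]; linear_combination hm
  rw [Matrix.mul_apply]
  have e : ∀ k, coneMetric c y i k * (Matrix.of fun i j : Fin 3 =>
      (if i = j then (1 : ℝ) else 0) - b * (y i * y j) * ‖y‖⁻¹ ^ 2) k j =
      (if i = k then (if k = j then 1 else 0) - b * (y k * y j) * ‖y‖⁻¹ ^ 2 else 0) +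
      (if k = j then c ^ 2 * (y i * y k) * ‖y‖⁻¹ ^ 2 else 0) -
      c ^ 2 * b * y i * y j * ‖y‖⁻¹ ^ 2 * (y k * y k * ‖y‖⁻¹ ^ 2) := by
    intro k
    simp only [coneMetric, Matrix.of_apply, div_eq_mul_inv, ← inv_pow]
    split_ifs <;> ring
  simp only [e, Finset.sum_sub_distrib, Finset.sum_add_distrib, ← Finset.mul_sum, hsum,
    Finset.sum_ite_eq, Finset.sum_ite_eq', Finset.mem_univ, if_true, Matrix.one_apply]
  linear_combination -(y i * y j * ‖y‖⁻¹ ^ 2) * hb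

theorem coneMetric_det (c : ℝ) (hy : y ≠ 0) : (coneMetric c y).det = 1 + c ^ 2 := by
  have hm := norm_inv_sq_mul_sum hy
  rw [Matrix.det_fin_three]
  simp [coneMetric, div_eq_mul_inv, ← inv_pow]
  linear_combination c ^ 2 * hm

theorem coneGradSq_eq (c : ℝ) (hy : y ≠ 0) (h : HasPartials F d y) :
    coneGradSq c F y = ∑ i, d i ^ 2 - (1 - 1 / (1 + c ^ 2)) * ‖y‖⁻¹ ^ 2 * (∑ i, y i * d i) ^ 2 := by
  simp only [coneGradSq, coneMetric_inv c hy, h.partialD, Fin.sum_univ_three, Matrix.of_apply]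
  simp
  ring

/-- The Laplace-Beltrami operator of the cone as the Euclidean divergence of
`d - (1 - 1/(1+c²)) (y·d) y / |y|²`, where `d` is the Euclidean gradient. -/
theorem coneLaplacian_eq (c : ℝ) {D : EuclideanSpace ℝ (Fin 3) → Fin 3 → ℝ}
    {X : Fin 3 → EuclideanSpace ℝ (Fin 3) → ℝ} {E : Fin 3 → Fin 3 → ℝ} (hy : y ≠ 0)
    (h : ∀ᶠ z in 𝓝 y, HasPartials F (D z) z)
    (hX : ∀ j, ∀ᶠ z in 𝓝 y,
      X j z = D z j - (1 - 1 / (1 + c ^ 2)) * z j * ‖z‖⁻¹ ^ 2 * ∑ i, z i * D z i)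
    (hE : ∀ j, HasPartials (X j) (E j) y) :
    coneLaplacian c F y = ∑ j, E j j := by
  have hs : √(1 + c ^ 2) ≠ 0 := by positivity
  -- The determinant is constant away from the vertex, so the two density factors cancel.
  rw [coneLaplacian, coneMetric_det c hy, Finset.mul_sum]
  refine Finset.sum_congr rfl fun j _ => ?_
  have : HasPartials (fun z => √(coneMetric c z).det *
      ∑ i : Fin 3, (coneMetric c z)⁻¹ i j * partialD i F z)
      (fun k => √(1 + c ^ 2) * E j k) y := by
    refine ((hE j).const_mul √(1 + c ^ 2)).congr ?_ fun k => rfl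
    filter_upwards [h, hX j, isOpen_ne.mem_nhds hy] with z hz hXz hz0
    rw [coneMetric_det c hz0, hXz, coneMetric_inv c hz0]
    simp only [hz.partialD, Matrix.of_apply, Fin.sum_univ_three]
    congr 1
    fin_cases j <;> simp <;> ring
  rw [this.partialD, inv_mul_cancel_left₀ hs]

/-- The flux field of `r^α p(cos φ)`, where `q` is the derivative of `p`. -/
noncomputable def homFlux (κ α : ℝ) (p q : ℝ → ℝ) (j : Fin 3) (y : EuclideanSpace ℝ (Fin 3)) : ℝ :=
  ‖y‖ ^ α * (α * κ * (‖y‖⁻¹ ^ 2 * (y j * p (cosAngle y))) + q (cosAngle y) *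
    ((if j = 2 then 1 else 0) * ‖y‖⁻¹ - y 2 * y j * ‖y‖⁻¹ ^ 3))

theorem homFlux_eq {κ α : ℝ} {p q : ℝ → ℝ} (hy : y ≠ 0) (j : Fin 3) :
    homFlux κ α p q j y =
      homGrad α p q y j - (1 - κ) * y j * ‖y‖⁻¹ ^ 2 * ∑ i, y i * homGrad α p q y i := by
  rw [sum_mul_homGrad hy, homFlux, homGrad, homFn]
  ring

/-- The trace of E is the divergence of the flux. It reduces the Laplace equation to an ordinary
differential equation in cos φ with eigenvalue parameter κα(α+1). -/
theorem exists_hasPartials_homFlux {κ α s : ℝ} {p q : ℝ → ℝ} (hy : y ≠ 0)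
    (hp : HasDerivAt p (q (cosAngle y)) (cosAngle y)) (hq : HasDerivAt q s (cosAngle y)) :
    ∃ E : Fin 3 → Fin 3 → ℝ, (∀ j, HasPartials (homFlux κ α p q j) (E j) y) ∧
      ∑ j, E j j = ‖y‖ ^ α * ‖y‖⁻¹ ^ 2 * ((1 - cosAngle y ^ 2) * s
        - 2 * cosAngle y * q (cosAngle y) + κ * (α * (α + 1)) * p (cosAngle y)) := by
  have hm := hasPartials_norm_inv hy
  have hP := HasPartials.comp hp (hasPartials_cosAngle hy)
  have hQ := HasPartials.comp hq (hasPartials_cosAngle hy)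
  have key : ∀ j, _ := fun j => (hasPartials_norm_rpow α hy).mul
    ((((hm.mul hm).mul ((hasPartials_coord j y).mul hP)).const_mul (α * κ)).add
      (hQ.mul ((hm.const_mul (if j = 2 then 1 else 0)).sub
        (((hasPartials_coord 2 y).mul (hasPartials_coord j y)).mul (hm.mul (hm.mul hm))))))
  refine ⟨_, fun j => (key j).congr (Eventually.of_forall fun z => ?_) fun _ => rfl, ?_⟩
  · simp only [homFlux]; ring
  · have h1 := norm_inv_sq_mul_sum hy
    have ht : cosAngle y = y 2 * ‖y‖⁻¹ := div_eq_mul_inv _ _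
    simp only [Fin.sum_univ_three]
    simp
    rw [← inv_pow]
    generalize p (cosAngle y) = P
    generalize q (cosAngle y) = Q
    rw [ht]
    generalize ‖y‖ ^ α = R at *
    simp only [← inv_pow] at *
    generalize ‖y‖⁻¹ = m at *
    generalize y 0 = y0 at *
    generalize y 1 = y1 at *
    generalize y 2 = y2 at *
    linear_combination (R * m ^ 2 * (α * κ * P * (α - 2) - m * Q * y2 * (α * κ + α - 3)
      + m ^ 2 * y2 ^ 2 * s)) * h1

end Calculus

/-! ### The function v and its free boundary -/

section Subsolution

variable {c a ε t tc : ℝ} {y : EuclideanSpace ℝ (Fin 3)}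

/-- The radial part A y and the angular part B ∇cos φ are orthogonal. The inverse metric scales only
the former by κ, and |∇cos φ|² = (1 - cos²φ)/r². -/
theorem coneGradSq_of_hasPartials (c : ℝ) {F : EuclideanSpace ℝ (Fin 3) → ℝ} {A B : ℝ}
    (hy : y ≠ 0) (h : HasPartials F
      (fun j => A * y j + B * ((if j = 2 then 1 else 0) * ‖y‖⁻¹ - y 2 * y j * ‖y‖⁻¹ ^ 3)) y) :
    coneGradSq c F y =
      1 / (1 + c ^ 2) * (A * ‖y‖) ^ 2 + (1 - cosAngle y ^ 2) * (B * ‖y‖⁻¹) ^ 2 := by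
  have hm := norm_inv_sq_mul_sum hy
  have hn : ‖y‖⁻¹ * ‖y‖ = 1 := inv_mul_cancel₀ (norm_ne_zero_iff.2 hy)
  have ht : cosAngle y = y 2 * ‖y‖⁻¹ := div_eq_mul_inv _ _
  have hρ : y 0 ^ 2 + y 1 ^ 2 + y 2 ^ 2 = ‖y‖ ^ 2 := by
    rw [EuclideanSpace.real_norm_sq_eq, Fin.sum_univ_three]
  have e0 : y 0 ^ 2 = ‖y‖ ^ 2 - y 1 ^ 2 - y 2 ^ 2 := by linarith
  rw [coneGradSq_eq c hy h, ht]
  generalize 1 / (1 + c ^ 2) = κ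
  have hS : ∑ i, y i * (A * y i + B * ((if i = 2 then 1 else 0) * ‖y‖⁻¹ - y 2 * y i * ‖y‖⁻¹ ^ 3)) =
      A * ‖y‖ ^ 2 := by
    simp only [Fin.sum_univ_three]
    simp
    rw [← inv_pow]
    linear_combination A * hρ - B * y 2 * ‖y‖⁻¹ * hm
  rw [hS]
  simp only [Fin.sum_univ_three]
  simp
  simp only [← inv_pow]
  generalize ‖y‖⁻¹ = m at *
  generalize ‖y‖ = r at *
  linear_combination (A ^ 2) * hρ +
    (-2 * A * B * m * y 2 + B ^ 2 * m ^ 4 * y 2 ^ 2) * hm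
    - (1 - κ) * A ^ 2 * r ^ 2 * (m * r + 1) * hn

theorem cosAngle_mem (hy : -‖y‖ < y 2) : cosAngle y ∈ Ioc (-1 : ℝ) 1 := by
  have h2 : y 2 ≤ ‖y‖ := (le_abs_self _).trans (PiLp.norm_apply_le y 2)
  have hn : 0 < ‖y‖ := by linarith
  exact ⟨by rw [cosAngle, lt_div_iff₀ hn]; linarith, by rw [cosAngle, div_le_one hn]; exact h2⟩

theorem ne_zero_of_neg_norm_lt (hy : -‖y‖ < y 2) : y ≠ 0 := by
  rintro rfl
  simp at hy

theorem isOpen_neg_norm_lt : IsOpen {y : EuclideanSpace ℝ (Fin 3) | -‖y‖ < y 2} :=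
  isOpen_lt (by fun_prop) (by fun_prop)

theorem contDiffAt_cosAngle (hy : y ≠ 0) : ContDiffAt ℝ 2 cosAngle y :=
  (contDiff_piLp_apply 2 (i := (2 : Fin 3))).contDiffAt.div (contDiffAt_norm ℝ hy)
    (norm_ne_zero_iff.2 hy)

theorem contDiffAt_homFn (α : ℝ) {p : ℝ → ℝ} (hy : y ≠ 0) (hp : ContDiffAt ℝ 2 p (cosAngle y)) :
    ContDiffAt ℝ 2 (homFn α p) y :=
  ((contDiffAt_norm ℝ hy).rpow_const_of_ne (norm_ne_zero_iff.2 hy)).mul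
    (hp.comp y (contDiffAt_cosAngle hy))

theorem continuousAt_homFn (α : ℝ) {p : ℝ → ℝ} (hy : y ≠ 0) (hp : ContinuousAt p (cosAngle y)) :
    ContinuousAt (homFn α p) y :=
  (hasPartials_norm_rpow α hy).continuousAt.mul
    (hp.comp (hasPartials_cosAngle hy).continuousAt)

theorem fCone_param_mem (c : ℝ) : 2 / (1 + c ^ 2) ∈ Ioc (0 : ℝ) 2 := by
  have := one_div_one_add_sq_mem c
  rw [fCone_param]
  constructor <;> linarith [this.1, this.2]

theorem gCone_param_mem (c : ℝ) : -(1 / 4) / (1 + c ^ 2) ∈ Icc (-1 : ℝ) 0 := by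
  have := one_div_one_add_sq_mem c
  rw [gCone_param]
  constructor <;> linarith [this.1, this.2]

theorem gCone_eq_legendreFn (c : ℝ) : gCone c = legendreFn (-(1 / 4) / (1 + c ^ 2)) := rfl

theorem deriv_fCone_eq (c a : ℝ) :
    deriv (fCone c a) = fun t => a * deriv (legendreFn (2 / (1 + c ^ 2))) t := by
  rw [deriv_fCone, fCone_param]

theorem hasDerivAt_fCone (c a : ℝ) (ht : t ∈ Ioo (-1 : ℝ) 3) :
    HasDerivAt (fCone c a) (deriv (fCone c a) t) t := by
  have := fCone_param_mem c
  rw [deriv_fCone_eq]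
  exact (hasDerivAt_legendreFn (by linarith [this.1]) this.2 ht).const_mul a

theorem hasDerivAt_deriv_fCone (c a : ℝ) (ht : t ∈ Ioo (-1 : ℝ) 3) :
    HasDerivAt (deriv (fCone c a)) (a * deriv (deriv (legendreFn (2 / (1 + c ^ 2)))) t) t := by
  have := fCone_param_mem c
  rw [deriv_fCone_eq]
  exact (hasDerivAt_deriv_legendreFn (by linarith [this.1]) this.2 ht).const_mul a

theorem hasDerivAt_gCone (c : ℝ) (ht : t ∈ Ioo (-1 : ℝ) 3) :
    HasDerivAt (gCone c) (deriv (gCone c) t) t := by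
  have := gCone_param_mem c
  exact hasDerivAt_legendreFn this.1 (by linarith [this.2]) ht

theorem hasDerivAt_deriv_gCone (c : ℝ) (ht : t ∈ Ioo (-1 : ℝ) 3) :
    HasDerivAt (deriv (gCone c)) (deriv (deriv (gCone c)) t) t := by
  have := gCone_param_mem c
  exact hasDerivAt_deriv_legendreFn this.1 (by linarith [this.2]) ht

theorem one_le_gCone (c : ℝ) (ht : t ∈ Ioc (-1 : ℝ) 1) : 1 ≤ gCone c t :=
  one_le_legendreFn (gCone_param_mem c).1 (gCone_param_mem c).2 ht

theorem fCone_le (c : ℝ) (ha : 0 ≤ a) (ht : t ∈ Ioc (-1 : ℝ) 1) : fCone c a t ≤ a := by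
  have h := fCone_param_mem c
  have := legendreFn_le h.1.le h.2 ht
  have h1 : 0 ≤ 2 / (1 + c ^ 2) / 2 * (1 - t) :=
    mul_nonneg (by linarith [h.1]) (by linarith [ht.2])
  exact mul_le_of_le_one_right ha (by linarith)

/-- `r f_c(cos φ) - ε r^{-1/2} g_c(cos φ)`. -/
noncomputable def coneDiff (c a ε : ℝ) (y : EuclideanSpace ℝ (Fin 3)) : ℝ :=
  homFn 1 (fCone c a) y - ε * homFn (-(1 / 2)) (gCone c) y

theorem coneSub_of_lt (hy : -‖y‖ < y 2) : coneSub c a ε y = max (coneDiff c a ε y) 0 := by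
  rw [coneSub, if_pos hy, coneDiff, homFn, homFn, Real.rpow_one, cosAngle, mul_assoc]

theorem coneSub_nonneg (c a ε : ℝ) (y : EuclideanSpace ℝ (Fin 3)) : 0 ≤ coneSub c a ε y := by
  rw [coneSub]
  split_ifs
  exacts [le_max_right _ _, le_rfl]

theorem neg_norm_lt_of_coneSub_pos (h : 0 < coneSub c a ε y) : -‖y‖ < y 2 := by
  by_contra hy
  rw [coneSub, if_neg hy] at h
  exact h.false

theorem coneDiff_pos_of_coneSub_pos (h : 0 < coneSub c a ε y) : 0 < coneDiff c a ε y := by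
  rw [coneSub_of_lt (neg_norm_lt_of_coneSub_pos h)] at h
  simpa using h

theorem hasPartials_coneDiff (hy : -‖y‖ < y 2) :
    HasPartials (coneDiff c a ε) (fun j => homGrad 1 (fCone c a) (deriv (fCone c a)) y j
      - ε * homGrad (-(1 / 2)) (gCone c) (deriv (gCone c)) y j) y := by
  have hy0 := ne_zero_of_neg_norm_lt hy
  have ht := mem_Ioo_of_mem_Ioc (cosAngle_mem hy)
  exact (hasPartials_homFn hy0 (hasDerivAt_fCone c a ht)).sub
    ((hasPartials_homFn hy0 (hasDerivAt_gCone c ht)).const_mul ε)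

theorem contDiffAt_coneDiff (hy : -‖y‖ < y 2) : ContDiffAt ℝ 2 (coneDiff c a ε) y := by
  have hy0 := ne_zero_of_neg_norm_lt hy
  have ht := isOpen_Ioo.mem_nhds (mem_Ioo_of_mem_Ioc (cosAngle_mem hy))
  have hf := fCone_param_mem c
  have hg := gCone_param_mem c
  refine (contDiffAt_homFn 1 hy0 ?_).sub (contDiffAt_const.mul (contDiffAt_homFn _ hy0 ?_))
  · exact contDiffAt_const.mul
      ((contDiffOn_legendreFn (by linarith [hf.1]) hf.2 2).contDiffAt ht)
  · exact (contDiffOn_legendreFn hg.1 (by linarith [hg.2]) 2).contDiffAt ht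

theorem coneSub_eventuallyEq (h : 0 < coneSub c a ε y) :
    coneSub c a ε =ᶠ[𝓝 y] coneDiff c a ε := by
  have hy := neg_norm_lt_of_coneSub_pos h
  filter_upwards [isOpen_neg_norm_lt.mem_nhds hy,
    (contDiffAt_coneDiff hy).continuousAt.eventually (lt_mem_nhds (coneDiff_pos_of_coneSub_pos h))]
    with z hz hz'
  rw [coneSub_of_lt hz, max_eq_left (le_of_lt hz')]

/-- Where v is positive, it is a difference of harmonic functions, since α(α+1) equals 2 for α = 1
and -1/4 for α = -1/2. -/
theorem coneLaplacian_coneSub (h : 0 < coneSub c a ε y) : coneLaplacian c (coneSub c a ε) y = 0 := by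
  have hy := neg_norm_lt_of_coneSub_pos h
  have hy0 := ne_zero_of_neg_norm_lt hy
  have ht := mem_Ioo_of_mem_Ioc (cosAngle_mem hy)
  have hf := fCone_param_mem c
  have hg := gCone_param_mem c
  obtain ⟨E₁, hE₁, hs₁⟩ := exists_hasPartials_homFlux (κ := 1 / (1 + c ^ 2)) (α := 1) hy0
    (hasDerivAt_fCone c a ht) (hasDerivAt_deriv_fCone c a ht)
  obtain ⟨E₂, hE₂, hs₂⟩ := exists_hasPartials_homFlux (κ := 1 / (1 + c ^ 2)) (α := -(1 / 2)) hy0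
    (hasDerivAt_gCone c ht) (hasDerivAt_deriv_gCone c ht)
  rw [coneLaplacian_eq c (D := fun z j => homGrad 1 (fCone c a) (deriv (fCone c a)) z j
      - ε * homGrad (-(1 / 2)) (gCone c) (deriv (gCone c)) z j) (X := fun j z =>
      homFlux (1 / (1 + c ^ 2)) 1 (fCone c a) (deriv (fCone c a)) j z
      - ε * homFlux (1 / (1 + c ^ 2)) (-(1 / 2)) (gCone c) (deriv (gCone c)) j z) hy0 ?_ ?_
    (fun j => (hE₁ j).sub ((hE₂ j).const_mul ε)), Finset.sum_sub_distrib, ← Finset.mul_sum,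
    hs₁, hs₂]
  · have ef := legendreFn_ode (by linarith [hf.1]) hf.2 ht
    have eg := legendreFn_ode hg.1 (by linarith [hg.2]) ht
    rw [deriv_fCone_eq, gCone_eq_legendreFn]
    simp only [fCone]
    generalize legendreFn (2 / (1 + c ^ 2)) = f at *
    generalize legendreFn (-(1 / 4) / (1 + c ^ 2)) = g at *
    linear_combination a * ‖y‖ ^ (1 : ℝ) * ‖y‖⁻¹ ^ 2 * ef
      - ε * ‖y‖ ^ (-(1 / 2) : ℝ) * ‖y‖⁻¹ ^ 2 * eg
  · filter_upwards [(coneSub_eventuallyEq h).eventuallyEq_nhds, isOpen_neg_norm_lt.mem_nhds hy]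
      with z hz hz'
    exact (hasPartials_coneDiff hz').congr hz fun j => rfl
  · intro j
    filter_upwards [isOpen_ne.mem_nhds hy0] with z hz
    simp only [homFlux_eq hz, mul_sub, Finset.sum_sub_distrib, mul_left_comm _ ε, ← Finset.mul_sum]
    ring

/-- The value of `|∇_c v|²` at points where `v` is positive, as a function on the whole cone
except for `φ = π`. -/
noncomputable def coneDiffGradSq (c a ε : ℝ) (y : EuclideanSpace ℝ (Fin 3)) : ℝ :=
  1 / (1 + c ^ 2) *
      (‖y‖⁻¹ * (homFn 1 (fCone c a) y + ε / 2 * homFn (-(1 / 2)) (gCone c) y)) ^ 2 +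
    (1 - cosAngle y ^ 2) * (‖y‖⁻¹ *
      (homFn 1 (deriv (fCone c a)) y - ε * homFn (-(1 / 2)) (deriv (gCone c)) y)) ^ 2

theorem coneGradSq_coneSub (h : 0 < coneSub c a ε y) :
    coneGradSq c (coneSub c a ε) y = coneDiffGradSq c a ε y := by
  have hy := neg_norm_lt_of_coneSub_pos h
  have hy0 := ne_zero_of_neg_norm_lt hy
  have hn : ‖y‖⁻¹ * ‖y‖ = 1 := inv_mul_cancel₀ (norm_ne_zero_iff.2 hy0)
  rw [coneGradSq_of_hasPartials c hy0 (F := coneSub c a ε)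
    (A := ‖y‖⁻¹ ^ 2 * (homFn 1 (fCone c a) y + ε / 2 * homFn (-(1 / 2)) (gCone c) y))
    (B := homFn 1 (deriv (fCone c a)) y - ε * homFn (-(1 / 2)) (deriv (gCone c)) y)]
  · rw [coneDiffGradSq]
    have e : ∀ z, ‖y‖⁻¹ ^ 2 * z * ‖y‖ = ‖y‖⁻¹ * z := fun z => by
      linear_combination ‖y‖⁻¹ * z * hn
    rw [e, mul_comm _ ‖y‖⁻¹]
  · refine (hasPartials_coneDiff hy).congr (coneSub_eventuallyEq h) fun j => ?_
    simp only [homGrad, homFn]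
    ring

theorem continuousAt_coneDiffGradSq (hy : -‖y‖ < y 2) :
    ContinuousAt (coneDiffGradSq c a ε) y := by
  have hy0 := ne_zero_of_neg_norm_lt hy
  have ht := mem_Ioo_of_mem_Ioc (cosAngle_mem hy)
  have hm := (hasPartials_norm_inv hy0).continuousAt
  have hT := (hasPartials_cosAngle hy0).continuousAt
  have h1 := continuousAt_homFn 1 hy0 (hasDerivAt_fCone c a ht).continuousAt
  have h2 := continuousAt_homFn (-(1 / 2)) hy0 (hasDerivAt_gCone c ht).continuousAt
  have h3 := continuousAt_homFn 1 hy0 (hasDerivAt_deriv_fCone c a ht).continuousAt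
  have h4 := continuousAt_homFn (-(1 / 2)) hy0 (hasDerivAt_deriv_gCone c ht).continuousAt
  unfold coneDiffGradSq
  fun_prop

/-- On the zero set ε r^(-3/2) g = f. The radial term f + (ε/2) r^(-3/2) g becomes (3/2) f, whence
9/4, and the angular term becomes f' - f g'/g. -/
theorem coneDiffGradSq_eq_GCone (hy : -‖y‖ < y 2) (h : coneDiff c a ε y = 0) :
    coneDiffGradSq c a ε y = GCone c a (cosAngle y) := by
  have hy0 := ne_zero_of_neg_norm_lt hy
  have hn : ‖y‖⁻¹ * ‖y‖ = 1 := inv_mul_cancel₀ (norm_ne_zero_iff.2 hy0)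
  have hg := one_le_gCone c (cosAngle_mem hy)
  have hg0 : gCone c (cosAngle y) ≠ 0 := by linarith
  rw [coneDiff, sub_eq_zero] at h
  simp only [homFn, Real.rpow_one] at h
  have h' : ‖y‖⁻¹ * (ε * ‖y‖ ^ (-(1 / 2) : ℝ)) =
      fCone c a (cosAngle y) / gCone c (cosAngle y) := by
    rw [eq_div_iff hg0]
    linear_combination -‖y‖⁻¹ * h + fCone c a (cosAngle y) * hn
  rw [coneDiffGradSq, GCone]
  simp only [homFn, Real.rpow_one]
  have e1 : ‖y‖⁻¹ * (‖y‖ * fCone c a (cosAngle y) + ε / 2 * (‖y‖ ^ (-(1 / 2) : ℝ) *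
      gCone c (cosAngle y))) = 3 / 2 * fCone c a (cosAngle y) := by
    linear_combination -‖y‖⁻¹ / 2 * h + 3 / 2 * fCone c a (cosAngle y) * hn
  have e2 : ‖y‖⁻¹ * (‖y‖ * deriv (fCone c a) (cosAngle y) - ε * (‖y‖ ^ (-(1 / 2) : ℝ) *
      deriv (gCone c) (cosAngle y))) = deriv (fCone c a) (cosAngle y) -
      fCone c a (cosAngle y) * (deriv (gCone c) (cosAngle y) / gCone c (cosAngle y)) := by
    linear_combination deriv (fCone c a) (cosAngle y) * hn - deriv (gCone c) (cosAngle y) * h'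
  rw [e1, e2]
  ring

theorem fCone_pos_of_coneDiff_nonneg (hε : 0 < ε) (hy : -‖y‖ < y 2) (h : 0 ≤ coneDiff c a ε y) :
    0 < fCone c a (cosAngle y) := by
  have hn : 0 < ‖y‖ := norm_pos_iff.2 (ne_zero_of_neg_norm_lt hy)
  have hg := one_le_gCone c (cosAngle_mem hy)
  have h2 : 0 < ε * homFn (-(1 / 2)) (gCone c) y :=
    mul_pos hε (mul_pos (Real.rpow_pos_of_pos hn _) (by linarith))
  rw [coneDiff, homFn, Real.rpow_one] at h
  exact pos_of_mul_pos_right (a := ‖y‖) (by linarith) hn.le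

/-- Since f_c ≤ a and g_c ≥ 1, positivity of v forces r away from 0; hence v vanishes near the
vertex. -/
theorem lt_norm_rpow_of_coneSub_pos (ha : 0 ≤ a) (hε : 0 < ε) (h : 0 < coneSub c a ε y) :
    ε < a * ‖y‖ ^ (3 / 2 : ℝ) := by
  have hy := neg_norm_lt_of_coneSub_pos h
  have hn : 0 < ‖y‖ := norm_pos_iff.2 (ne_zero_of_neg_norm_lt hy)
  have hV := coneDiff_pos_of_coneSub_pos h
  have hR : 0 < ‖y‖ ^ (-(1 / 2) : ℝ) := Real.rpow_pos_of_pos hn _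
  have e : ‖y‖ = ‖y‖ ^ (-(1 / 2) : ℝ) * ‖y‖ ^ (3 / 2 : ℝ) := by
    rw [← Real.rpow_add hn]; norm_num
  have h1 : ‖y‖ * fCone c a (cosAngle y) ≤ ‖y‖ * a :=
    mul_le_mul_of_nonneg_left (fCone_le c ha (cosAngle_mem hy)) hn.le
  have h2 : ε * (‖y‖ ^ (-(1 / 2) : ℝ) * 1) ≤ ε * (‖y‖ ^ (-(1 / 2) : ℝ) * gCone c (cosAngle y)) := by
    gcongr
    exact one_le_gCone c (cosAngle_mem hy)
  rw [coneDiff, homFn, homFn, Real.rpow_one] at hV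
  refine lt_of_mul_lt_mul_left ?_ hR.le
  have h3 : ‖y‖ * a = ‖y‖ ^ (-(1 / 2) : ℝ) * (a * ‖y‖ ^ (3 / 2 : ℝ)) := by
    nth_rewrite 1 [e]; ring
  linarith

/-- Near the vertex the term with ε dominates. Near φ = π, positivity of v would need f_c > 0, hence
cos φ > t_c > -1. -/
theorem coneSub_eventuallyEq_zero (ha : 0 ≤ a) (hε : 0 < ε) (htc : -1 < tc)
    (hpos : ∀ t ∈ Ioc (-1 : ℝ) 1, 0 < fCone c a t → tc < t) (hy : ¬ -‖y‖ < y 2) :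
    coneSub c a ε =ᶠ[𝓝 y] 0 := by
  rcases eq_or_ne y 0 with rfl | hy0
  · have hc : Continuous fun z : EuclideanSpace ℝ (Fin 3) => a * ‖z‖ ^ (3 / 2 : ℝ) :=
      continuous_const.mul (continuous_norm.rpow_const fun _ => Or.inr (by norm_num))
    have h0 : a * ‖(0 : EuclideanSpace ℝ (Fin 3))‖ ^ (3 / 2 : ℝ) < ε := by
      rw [norm_zero, Real.zero_rpow (by norm_num), mul_zero]
      exact hε
    filter_upwards [hc.continuousAt.eventually (gt_mem_nhds h0)] with z hz
    refine le_antisymm (not_lt.1 fun h => ?_) (coneSub_nonneg _ _ _ _)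
    exact lt_asymm hz (lt_norm_rpow_of_coneSub_pos ha hε h)
  · have hn := norm_pos_iff.2 hy0
    have hopen : IsOpen {z : EuclideanSpace ℝ (Fin 3) | z 2 < tc * ‖z‖} :=
      isOpen_lt (by fun_prop) (by fun_prop)
    have hmem : y 2 < tc * ‖y‖ := by nlinarith
    filter_upwards [hopen.mem_nhds hmem] with z hz
    refine le_antisymm (not_lt.1 fun h => ?_) (coneSub_nonneg _ _ _ _)
    have hz' := neg_norm_lt_of_coneSub_pos h
    have hz0 : 0 < ‖z‖ := norm_pos_iff.2 (ne_zero_of_neg_norm_lt hz')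
    have := hpos _ (cosAngle_mem hz')
      (fCone_pos_of_coneDiff_nonneg hε hz' (coneDiff_pos_of_coneSub_pos h).le)
    rw [cosAngle, lt_div_iff₀ hz0] at this
    exact lt_asymm hz this

theorem continuous_coneSub (ha : 0 ≤ a) (hε : 0 < ε) (htc : -1 < tc)
    (hpos : ∀ t ∈ Ioc (-1 : ℝ) 1, 0 < fCone c a t → tc < t) : Continuous (coneSub c a ε) := by
  refine continuous_iff_continuousAt.2 fun y => ?_
  by_cases hy : -‖y‖ < y 2
  · refine ContinuousAt.congr (f := fun z => max (coneDiff c a ε z) 0)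
      ((contDiffAt_coneDiff hy).continuousAt.max continuousAt_const) ?_
    filter_upwards [isOpen_neg_norm_lt.mem_nhds hy] with z hz
    exact (coneSub_of_lt hz).symm
  · exact continuousAt_const.congr (coneSub_eventuallyEq_zero ha hε htc hpos hy).symm

theorem isConeSubsolution_coneSub (ha : 0 ≤ a) (hε : 0 < ε) (htc : -1 < tc)
    (hpos : ∀ t ∈ Ioc (-1 : ℝ) 1, 0 < fCone c a t → tc < t)
    (hG : ∀ t ∈ Ioc tc 1, 1 < GCone c a t) {Ω : Set (EuclideanSpace ℝ (Fin 3))} (hΩ : IsOpen Ω) :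
    IsConeSubsolution c Ω (coneSub c a ε) := by
  have hcont := continuous_coneSub ha hε htc hpos
  refine ⟨fun y _ => coneSub_nonneg _ _ _ y, hcont.continuousOn, fun y hy => ?_,
    fun y _ h _ => (coneLaplacian_coneSub h).ge, fun x hx hfr _ => ?_⟩
  · exact ((contDiffAt_coneDiff (neg_norm_lt_of_coneSub_pos hy.2.1)).congr_of_eventuallyEq
      (coneSub_eventuallyEq hy.2.1)).contDiffWithinAt
  · have hopen : IsOpen {y | y ∈ Ω ∧ 0 < coneSub c a ε y} :=
      hΩ.inter (isOpen_lt continuous_const hcont)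
    rw [hopen.frontier_eq] at hfr
    have hfreq : ∃ᶠ y in 𝓝 x, 0 < coneSub c a ε y :=
      (mem_closure_iff_frequently.1 hfr.1).mono fun y hy => hy.2
    have hx0 : coneSub c a ε x = 0 :=
      le_antisymm (not_lt.1 fun h => hfr.2 ⟨hx, h⟩) (coneSub_nonneg _ _ _ x)
    have hxU : -‖x‖ < x 2 := by
      by_contra hxU
      refine hfreq ?_
      filter_upwards [coneSub_eventuallyEq_zero ha hε htc hpos hxU] with y hy
      simp [hy]
    have hV : coneDiff c a ε x = 0 := by
      refine le_antisymm ?_ ?_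
      · rw [coneSub_of_lt hxU] at hx0
        exact (le_max_left _ _).trans hx0.le
      · refine ge_of_tendsto_of_frequently (contDiffAt_coneDiff hxU).continuousAt ?_
        exact hfreq.mono fun y hy => (coneDiff_pos_of_coneSub_pos hy).le
    have ht := cosAngle_mem hxU
    have hlt : 1 < coneDiffGradSq c a ε x := by
      rw [coneDiffGradSq_eq_GCone hxU hV]
      exact hG _ ⟨hpos _ ht (fCone_pos_of_coneDiff_nonneg hε hxU hV.ge), ht.2⟩
    obtain ⟨b, hb1, hb⟩ := exists_between hlt
    have hb' : (1 : ENNReal) < ENNReal.ofReal √b := by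
      rw [ENNReal.one_lt_ofReal, Real.lt_sqrt zero_le_one]
      simpa using hb1
    -- Points with v > 0 accumulate at x. There |∇v|² agrees with an expression continuous at x, so
    -- the limsup is at least its value at x; gradients where v = 0 play no role.
    refine hb'.trans_le (le_limsup_of_frequently_le ?_)
    refine (hfreq.and_eventually ((continuousAt_coneDiffGradSq hxU).eventually
      (lt_mem_nhds hb))).mono fun y hy => ?_
    rw [coneGradSq_coneSub hy.1]
    exact ENNReal.ofReal_le_ofReal (Real.sqrt_le_sqrt (le_of_lt hy.2))

end Subsolution

/-! ### Assembly -/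

theorem theoremt (c : ℝ) (hc₀ : 0 ≤ c) (hc₁ : c ≤ 0.58828) :
    ∃ tc ∈ Ioo (-1 : ℝ) 1,
      (∀ t ∈ Ioc (-1 : ℝ) 1, fCone c 1 t = 0 ↔ t = tc) ∧
      (∀ a : ℝ, a ≠ 0 → ∀ t ∈ Ioo tc 1, 0 < deriv (GCone c a) t) ∧
      ∃ a : ℝ, 0 < a ∧
        deriv (fun φ : ℝ => fCone c a (Real.cos φ)) (Real.arccos tc) = -1 ∧
        ∀ ε : ℝ, 0 < ε → ∀ Ω : Set (EuclideanSpace ℝ (Fin 3)), IsOpen Ω →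
          IsConeSubsolution c Ω (coneSub c a ε) := by
  obtain ⟨κ, hκ⟩ : ∃ κ, κ = 1 / (1 + c ^ 2) := ⟨_, rfl⟩
  have hκ1 : κ ≤ 1 := hκ ▸ (one_div_one_add_sq_mem c).2
  have hκ0 : 7429 / 10000 ≤ κ := by
    rw [hκ, le_div_iff₀ (by positivity)]
    norm_num at hc₁
    nlinarith
  have hf : ∀ a, fCone c a = fun t => a * legendreFn (2 * κ) t := fun a => by
    rw [fCone_eq, hκ]
  obtain ⟨tc, htc, hz⟩ := exists_legendreFn_zero hκ0 hκ1
  have htc' : tc ∈ Ioc (-1 : ℝ) 1 := ⟨htc.1, htc.2.le⟩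
  have h0 := (hz tc htc').2 rfl
  have hG : ∀ a : ℝ, a ≠ 0 → ∀ t ∈ Ioo tc 1, 0 < deriv (GCone c a) t := fun a ha t ht => by
    rw [(hasDerivAt_GCone ⟨htc.1.trans ht.1, ht.2.le⟩ hκ).deriv]
    exact mul_pos (by positivity) (legendreFn_gradient_deriv_pos hκ0 hκ1 htc h0 ht)
  refine ⟨tc, htc, fun t ht => by simp only [hf, one_mul, hz t ht], hG, ?_⟩
  have hD : 0 < deriv (legendreFn (2 * κ)) tc := by
    have := le_deriv_legendreFn (β := 2 * κ) (by linarith) (by linarith) htc'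
    linarith
  have hq : 0 < 1 - tc ^ 2 := by nlinarith [htc.1, htc.2]
  have hs : 0 < √(1 - tc ^ 2) := Real.sqrt_pos.2 hq
  -- The derivative of f_c(cos φ) at φ_c is -sin φ_c · a f'(t_c), with sin φ_c = √(1 - t_c²).
  obtain ⟨a, ha⟩ : ∃ a, a = (√(1 - tc ^ 2) * deriv (legendreFn (2 * κ)) tc)⁻¹ := ⟨_, rfl⟩
  have ha0 : 0 < a := by rw [ha]; positivity
  have ha1 : √(1 - tc ^ 2) * deriv (legendreFn (2 * κ)) tc * a = 1 := by
    rw [ha]; exact mul_inv_cancel₀ (by positivity)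
  have hd : deriv (fCone c a) tc = a * deriv (legendreFn (2 * κ)) tc := by
    rw [deriv_fCone, hκ]
  refine ⟨a, ha0, ?_, fun ε hε Ω hΩ => ?_⟩
  · have hcos : Real.cos (Real.arccos tc) = tc := Real.cos_arccos htc.1.le htc.2.le
    have h1 : HasDerivAt (fCone c a) (deriv (fCone c a) tc) (Real.cos (Real.arccos tc)) := by
      rw [hcos]
      exact hasDerivAt_fCone c a (mem_Ioo_of_mem_Ioc htc')
    have h2 := (h1.comp _ (Real.hasDerivAt_cos (Real.arccos tc))).deriv
    rw [Real.sin_arccos, hd] at h2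
    refine Eq.trans h2 ?_
    linear_combination -ha1
  · refine isConeSubsolution_coneSub ha0.le hε htc.1 (fun t ht hpos => ?_) (fun t ht => ?_) hΩ
    · rw [hf] at hpos
      have hpos' := pos_of_mul_pos_right hpos ha0.le
      rw [← h0] at hpos'
      exact (strictMonoOn_legendreFn (by linarith) (by linarith)).lt_iff_lt htc' ht |>.1 hpos'
    · have hd' : ∀ s ∈ Icc tc 1, _ := fun s hs =>
        hasDerivAt_GCone (c := c) (a := a) (Icc_subset_Ioc_neg_one htc.1 le_rfl hs) hκ
      have hmono := strictMonoOn_of_deriv_pos (convex_Icc tc 1)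
        (fun s hs => (hd' s hs).continuousAt.continuousWithinAt)
        (fun s hs => hG a ha0.ne' s (by rwa [interior_Icc] at hs))
      have hlt := hmono (left_mem_Icc.2 htc.2.le) ⟨ht.1.le, ht.2⟩ ht.1
      -- As f_c(t_c) = 0, only (1 - t_c²) f_c'(t_c)² remains, which is the square of the normalized
      -- slope.
      have h1 : GCone c a tc = 1 := by
        rw [GCone, hd, hf]
        simp only [h0]
        have hsq := Real.sq_sqrt hq.le
        linear_combination (√(1 - tc ^ 2) * deriv (legendreFn (2 * κ)) tc * a + 1) * ha1
          - (a * deriv (legendreFn (2 * κ)) tc) ^ 2 * hsq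
      rwa [h1] at hlt
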